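/- All graphs are finite and simple, and a path contains an edge if the edge is one of its edges. Let $G$ be a graph. A set $\mathscr{P}$ of paths of $G$ is strongly separating if for every ordered pair $(e,f)$ of distinct edges of $G$ some path in $\mathscr{P}$ contains $e$ and avoids $f$; let $c_\infty(G)$ be the smallest size of a strongly separating set of paths of $G$. For an integer $k\ge 2$, a multiset $\mathscr{P}$ of paths of $G$ is a $k$-rainbow separating path system if its elements can be colored with $k$ colors (not all of which need be used) so that for every pair of distinct edges $e_1,e_2$ of $G$ there are paths $P_1,P_2\in\mathscr{P}$ of distinct colors such that $P_1$ contains $e_1$ but not $e_2$ and $P_2$ contains $e_2$ but not $e_1$; let $c_k(G)$ be the smallest cardinality of a $k$-rainbow separating path system of $G$. The chromatic separation number of $G$ is $$\chi_{rs}(G):=\min\{k\in\{2,3,\dots\} : c_k(G)=c_\infty(G)\}.$$ **Corollary.** For every integer $k\ge 3$ there are infinitely many pairwise non-isomorphic trees $T$ with $\chi_{rs}(T)=k$. -/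

import Mathlib

namespace RainbowSep

variable {V : Type*}

/-- The (simple, undirected) paths of `G`, as subgraphs of `G`. -/
def GraphPath (G : SimpleGraph V) : Type _ :=
  {H : G.Subgraph // ∃ (u v : V) (p : G.Walk u v), p.IsPath ∧ p.toSubgraph = H}

/-- The edge set of a path. -/
def GraphPath.edges {G : SimpleGraph V} (P : GraphPath G) : Set (Sym2 V) :=
  P.1.edgeSet

/-- A set of paths is strongly separating if for every ordered pair of distinct edges `(e, f)`
some path of the set contains `e` and avoids `f`. -/
def IsStronglySeparating (G : SimpleGraph V) (S : Set (GraphPath G)) : Prop :=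
  ∀ e ∈ G.edgeSet, ∀ f ∈ G.edgeSet, e ≠ f → ∃ P ∈ S, e ∈ P.edges ∧ f ∉ P.edges

/-- The strong separation number `ssp(G) = c_∞(G)`: the least size of a strongly separating
path system. -/
noncomputable def strongSepNumber (G : SimpleGraph V) : ℕ∞ :=
  ⨅ (S : Set (GraphPath G)) (_ : IsStronglySeparating G S), S.encard

/-- A multiset `M` of paths is a `k`-rainbow separating path system if its elements can be coloured
with `k` colours (`Q` is `M` with a colour attached to each element) such that any two distinct
edges `e`, `f` are separated by two paths of distinct colours. -/
def IsRainbowSeparating (G : SimpleGraph V) (k : ℕ) (M : Multiset (GraphPath G)) : Prop :=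
  ∃ Q : Multiset (GraphPath G × Fin k), Q.map Prod.fst = M ∧
    ∀ e ∈ G.edgeSet, ∀ f ∈ G.edgeSet, e ≠ f →
      ∃ x ∈ Q, ∃ y ∈ Q, x.2 ≠ y.2 ∧
        (e ∈ x.1.edges ∧ f ∉ x.1.edges) ∧ (f ∈ y.1.edges ∧ e ∉ y.1.edges)

/-- The `k`-rainbow separation number `c_k(G)`: the least cardinality of a `k`-rainbow separating
path system of `G`. -/
noncomputable def rainbowSepNumber (G : SimpleGraph V) (k : ℕ) : ℕ∞ :=
  ⨅ (M : Multiset (GraphPath G)) (_ : IsRainbowSeparating G k M), (Multiset.card M : ℕ∞)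

/-- The chromatic separation number `χ_rs(G)`: the least `k ≥ 2` such that `c_k(G) = c_∞(G)`
(and `⊤` if there is no such `k`). -/
noncomputable def chromaticSepNumber (G : SimpleGraph V) : ℕ∞ :=
  ⨅ (k : ℕ) (_ : 2 ≤ k ∧ rainbowSepNumber G k = strongSepNumber G), (k : ℕ∞)

end RainbowSep

/-!
Count how a separating family of paths covers the vertices of degree at most two: such a vertex is
an end of two of the paths, except that for a leaf one path suffices if it consists of the edge at
that leaf, and then it is counted twice. Since a path has only two ends, there are at least as many
paths as vertices of degree at most two. If equality holds, then (in the trees considered here) no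
path ends in a vertex of degree three and every leaf edge lies in exactly two paths. At a vertex of
degree three, in which no path ends, the set of paths through one edge is the symmetric difference
of the sets for the other two edges, so that this number propagates from the leaves inwards.

If a path of an optimal rainbow family contains several edges that lie in exactly two paths, then
the second paths through these edges have distinct colours. Hence a large binary tree needs many
colours, because a path that enters it must descend to a leaf. On the other hand, attaching two
leaves to a leaf costs one more path and at most one more colour: prolong the two paths that end in
the old leaf, and join the two new leaves by a path in a fresh colour. So the number of colours
takes every value from three on as the binary tree grows, since three colours suffice for a path
with a fork at each end; the length of that path is arbitrary up to divisibility, which yields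
infinitely many trees.
-/

namespace RainbowSep

variable {V V' ι C : Type*} {G : SimpleGraph V} {G' : SimpleGraph V'}

section Walk

variable {u v x : V} {q : G.Walk u v}

theorem ncard_neighborSet_toSubgraph_of_mem_support (hq : q.IsPath) (hx : x ∈ q.support)
    (hu : x ≠ u) (hv : x ≠ v) : (q.toSubgraph.neighborSet x).ncard = 2 := by
  obtain ⟨i, rfl, hi⟩ := SimpleGraph.Walk.mem_support_iff_exists_getVert.1 hx
  refine hq.ncard_neighborSet_toSubgraph_internal_eq_two ?_ (hi.lt_of_ne ?_)
  · rintro rfl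
    exact hu q.getVert_zero
  · rintro rfl
    exact hv q.getVert_length

theorem ncard_neighborSet_toSubgraph_start_le_one (hq : q.IsPath) :
    (q.toSubgraph.neighborSet u).ncard ≤ 1 := by
  by_cases hnil : q.Nil
  · cases hnil
    simp [SimpleGraph.Subgraph.neighborSet]
  · simp [hq.neighborSet_toSubgraph_startpoint hnil]

theorem ncard_neighborSet_toSubgraph_le_two (hq : q.IsPath) (x : V) :
    (q.toSubgraph.neighborSet x).ncard ≤ 2 := by
  by_cases hx : x ∈ q.support
  · by_cases hu : x = u
    · subst hu
      exact (ncard_neighborSet_toSubgraph_start_le_one hq).trans one_le_two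
    by_cases hv : x = v
    · subst hv
      simpa using (ncard_neighborSet_toSubgraph_start_le_one hq.reverse).trans one_le_two
    exact (ncard_neighborSet_toSubgraph_of_mem_support hq hx hu hv).le
  · have hempty : q.toSubgraph.neighborSet x = ∅ := Set.eq_empty_of_forall_notMem fun y hy =>
      hx (q.mem_verts_toSubgraph.1 (q.toSubgraph.edge_vert hy))
    simp [hempty]

end Walk

namespace GraphPath

variable {P : GraphPath G} {v w x y z l : V}

theorem edges_subset_edgeSet (P : GraphPath G) : P.edges ⊆ G.edgeSet :=
  P.1.edgeSet_subset

/-- A vertex is an end of a path if exactly one edge of the path is incident with it; so a path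
without edges has no ends. -/
def IsEnd (P : GraphPath G) (v : V) : Prop :=
  ∃! x, s(v, x) ∈ P.edges

theorem ncard_setOf_mk_mem_edges_le_two (P : GraphPath G) (v : V) :
    {x | s(v, x) ∈ P.edges}.ncard ≤ 2 := by
  obtain ⟨_, _, _, q, hq, rfl⟩ := P
  exact ncard_neighborSet_toSubgraph_le_two hq v

theorem finite_setOf_mk_mem_edges (P : GraphPath G) (v : V) : {x | s(v, x) ∈ P.edges}.Finite := by
  obtain ⟨_, _, _, q, -, rfl⟩ := P
  exact q.finite_neighborSet_toSubgraph

/-- The path traversed by a walk without repeated vertices. -/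
def ofWalk (q : G.Walk v w) (hq : q.IsPath) : GraphPath G :=
  ⟨q.toSubgraph, v, w, q, hq, rfl⟩

theorem mem_edges_ofWalk {q : G.Walk v w} {hq : q.IsPath} {e : Sym2 V} :
    e ∈ (ofWalk q hq).edges ↔ e ∈ q.edges :=
  q.mem_edges_toSubgraph

theorem exists_eq_ofWalk (P : GraphPath G) :
    ∃ (v w : V) (q : G.Walk v w) (hq : q.IsPath), P = ofWalk q hq := by
  obtain ⟨_, v, w, q, hq, rfl⟩ := P
  exact ⟨v, w, q, hq, rfl⟩

theorem IsEnd.eq_or_eq {q : G.Walk v w} {hq : q.IsPath} (h : (ofWalk q hq).IsEnd x) :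
    x = v ∨ x = w := by
  obtain ⟨y, hy, huniq⟩ := h
  have hone : q.toSubgraph.neighborSet x = {y} := Set.eq_singleton_iff_unique_mem.2 ⟨hy, huniq⟩
  by_contra! hne
  have htwo := ncard_neighborSet_toSubgraph_of_mem_support hq
    (q.fst_mem_support_of_mem_edges (mem_edges_ofWalk.1 hy)) hne.1 hne.2
  simp [hone] at htwo

theorem card_le_two_of_forall_isEnd {s : Finset V} (P : GraphPath G) (hs : ∀ v ∈ s, P.IsEnd v) :
    s.card ≤ 2 := by
  classical
  obtain ⟨v, w, q, hq, rfl⟩ := P.exists_eq_ofWalk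
  exact (Finset.card_le_card fun x hx => by simpa using (hs x hx).eq_or_eq).trans
    (Finset.card_le_two (a := v) (b := w))

theorem IsEnd.exists_walk (h : P.IsEnd l) :
    ∃ (v : V) (q : G.Walk l v), q.IsPath ∧ ∀ e, e ∈ P.edges ↔ e ∈ q.edges := by
  obtain ⟨v, w, q, hq, rfl⟩ := P.exists_eq_ofWalk
  obtain rfl | rfl := h.eq_or_eq
  · exact ⟨w, q, hq, fun _ => mem_edges_ofWalk⟩
  · exact ⟨v, q.reverse, hq.reverse, fun _ => by simp [mem_edges_ofWalk]⟩

theorem isEnd_of_existsUnique_adj {e : Sym2 V} (hv : ∃! t, G.Adj v t) (hve : v ∈ e)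
    (he : e ∈ P.edges) : P.IsEnd v := by
  obtain ⟨x, rfl⟩ := hve
  exact ⟨x, he, fun _ hy => hv.unique (P.edges_subset_edgeSet hy) (P.edges_subset_edgeSet he)⟩

theorem exists_edges_eq_singleton (h : G.Adj x y) : ∃ P : GraphPath G, P.edges = {s(x, y)} :=
  ⟨ofWalk h.toWalk (by simp [h.ne]), Set.ext fun e => by simp [mem_edges_ofWalk]⟩

theorem exists_edges_eq_pair (hxy : G.Adj x y) (hyz : G.Adj y z) (hxz : x ≠ z) :
    ∃ P : GraphPath G, P.edges = {s(x, y), s(y, z)} :=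
  ⟨ofWalk (.cons hxy hyz.toWalk) (by simp [hxy.ne, hyz.ne, hxz]),
    Set.ext fun e => by simp [mem_edges_ofWalk]⟩

theorem exists_edges_eq_image {f : G →g G'} (hf : Function.Injective f) (P : GraphPath G) :
    ∃ P' : GraphPath G', P'.edges = Sym2.map f '' P.edges := by
  obtain ⟨v, w, q, hq, rfl⟩ := P.exists_eq_ofWalk
  exact ⟨ofWalk (q.map f) (hq.map hf), Set.ext fun e => by simp [mem_edges_ofWalk]⟩

theorem IsEnd.exists_edges_eq_insert {f : G →g G'} (hf : Function.Injective f) (h : P.IsEnd l)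
    {a : V'} (ha : a ∉ Set.range f) (hadj : G'.Adj a (f l)) :
    ∃ P' : GraphPath G', P'.edges = insert s(a, f l) (Sym2.map f '' P.edges) := by
  obtain ⟨v, q, hq, hedges⟩ := h.exists_walk
  have hpath : (SimpleGraph.Walk.cons hadj (q.map f)).IsPath := by
    rw [SimpleGraph.Walk.cons_isPath_iff]
    refine ⟨hq.map hf, fun hmem => ha ?_⟩
    obtain ⟨x, -, hx⟩ := List.mem_map.1 (q.support_map f ▸ hmem)
    exact ⟨x, hx⟩
  exact ⟨ofWalk _ hpath, Set.ext fun e => by simp [mem_edges_ofWalk, hedges]⟩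

end GraphPath

section Families

variable {p : ι → GraphPath G} {c : ι → C} {e g : Sym2 V} {n k N : ℕ}

/-- A family of paths that separates any two distinct edges in both directions. -/
def Separates (G : SimpleGraph V) (p : ι → GraphPath G) : Prop :=
  ∀ e ∈ G.edgeSet, ∀ g ∈ G.edgeSet, e ≠ g → ∃ t, e ∈ (p t).edges ∧ g ∉ (p t).edges

/-- Two edges are separated in both directions by members of distinct colours of the family `p`,
coloured by `c`. -/
def IsRainbowSeparated (p : ι → GraphPath G) (c : ι → C) (e g : Sym2 V) : Prop :=
  ∃ t u, c t ≠ c u ∧ (e ∈ (p t).edges ∧ g ∉ (p t).edges) ∧ (g ∈ (p u).edges ∧ e ∉ (p u).edges)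

/-- A coloured family of paths that separates any two distinct edges by paths of distinct
colours. -/
def RainbowSeparates (G : SimpleGraph V) (p : ι → GraphPath G) (c : ι → C) : Prop :=
  ∀ e ∈ G.edgeSet, ∀ g ∈ G.edgeSet, e ≠ g → IsRainbowSeparated p c e g

/-- There is a rainbow separating family of `n` paths with `k` colours. The existence of a rainbow
separating multiset of paths is expressed by indexing its members by `Fin n`. -/
def HasRainbowFamily (G : SimpleGraph V) (n k : ℕ) : Prop :=
  ∃ (p : Fin n → GraphPath G) (c : Fin n → Fin k), RainbowSeparates G p c

theorem IsRainbowSeparated.symm (h : IsRainbowSeparated p c e g) : IsRainbowSeparated p c g e :=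
  let ⟨t, u, hne, ht, hu⟩ := h
  ⟨u, t, hne.symm, hu, ht⟩

theorem RainbowSeparates.separates (h : RainbowSeparates G p c) : Separates G p :=
  fun e he g hg hne => let ⟨t, _, _, ht, _⟩ := h e he g hg hne; ⟨t, ht⟩

theorem RainbowSeparates.comp_injective {D : Type*} (h : RainbowSeparates G p c) {r : C → D}
    (hr : Function.Injective r) : RainbowSeparates G p (r ∘ c) :=
  fun e he g hg hne => let ⟨t, u, htu, h⟩ := h e he g hg hne; ⟨t, u, hr.ne htu, h⟩

theorem RainbowSeparates.comp_surjective {κ : Type*} (h : RainbowSeparates G p c) {r : κ → ι}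
    (hr : Function.Surjective r) : RainbowSeparates G (p ∘ r) (c ∘ r) := by
  intro e he g hg hne
  obtain ⟨t, u, h⟩ := h e he g hg hne
  obtain ⟨t, rfl⟩ := hr t
  obtain ⟨u, rfl⟩ := hr u
  exact ⟨t, u, h⟩

theorem RainbowSeparates.hasRainbowFamily [Fintype ι] [Fintype C] (h : RainbowSeparates G p c) :
    HasRainbowFamily G (Fintype.card ι) (Fintype.card C) :=
  ⟨_, _, (h.comp_injective (Fintype.equivFin C).injective).comp_surjective
    (Fintype.equivFin ι).symm.surjective⟩

theorem exists_isRainbowSeparating_iff :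
    (∃ M, IsRainbowSeparating G k M ∧ M.card = n) ↔ HasRainbowFamily G n k := by
  constructor
  · rintro ⟨_, ⟨Q, rfl, hQ⟩, rfl⟩
    induction Q using Quotient.inductionOn with
    | _ l =>
      have hl : RainbowSeparates G (fun t => (l.get t).1) (fun t => (l.get t).2) := by
        intro e he g hg hne
        obtain ⟨x, hx, y, hy, h⟩ := hQ e he g hg hne
        obtain ⟨t, rfl⟩ := List.get_of_mem (Multiset.mem_coe.1 hx)
        obtain ⟨u, rfl⟩ := List.get_of_mem (Multiset.mem_coe.1 hy)
        exact ⟨t, u, h⟩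
      simpa using hl.hasRainbowFamily
  · rintro ⟨p, c, h⟩
    refine ⟨_, ⟨Finset.univ.val.map fun t => (p t, c t), rfl, fun e he g hg hne => ?_⟩, by simp⟩
    obtain ⟨t, u, h⟩ := h e he g hg hne
    exact ⟨_, Multiset.mem_map_of_mem _ (Finset.mem_univ t), _,
      Multiset.mem_map_of_mem _ (Finset.mem_univ u), h⟩

theorem rainbowSepNumber_lt_iff :
    rainbowSepNumber G k < n ↔ ∃ m < n, HasRainbowFamily G m k := by
  simp only [rainbowSepNumber, iInf_lt_iff, ← exists_isRainbowSeparating_iff, Nat.cast_lt]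
  exact ⟨fun ⟨M, hM, hlt⟩ => ⟨_, hlt, M, hM, rfl⟩, fun ⟨_, hlt, M, hM, hcard⟩ =>
    ⟨M, hM, hcard ▸ hlt⟩⟩

theorem strongSepNumber_lt_iff :
    strongSepNumber G < n ↔ ∃ m < n, ∃ p : Fin m → GraphPath G, Separates G p := by
  simp only [strongSepNumber, iInf_lt_iff]
  constructor
  · rintro ⟨S, hS, hlt⟩
    have hfin : S.Finite := Set.encard_lt_top_iff.1 (hlt.trans (ENat.natCast_lt_top n))
    obtain ⟨m, p, rfl⟩ := hfin.fin_embedding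
    have hcard : (Set.range p).encard = m := by
      rw [← Set.image_univ, p.injective.encard_image]
      simp
    refine ⟨m, by exact_mod_cast hcard ▸ hlt, p, fun e he g hg hne => ?_⟩
    obtain ⟨_, ⟨t, rfl⟩, ht⟩ := hS e he g hg hne
    exact ⟨t, ht⟩
  · rintro ⟨m, hlt, p, hp⟩
    refine ⟨Set.range p, fun e he g hg hne => ?_, ?_⟩
    · obtain ⟨t, ht⟩ := hp e he g hg hne
      exact ⟨p t, ⟨t, rfl⟩, ht⟩
    · rw [← Set.image_univ]
      refine (Set.encard_image_le _ _).trans_lt ?_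
      simpa using hlt

theorem chromaticSepNumber_eq_of_isLeast
    (hN : ∀ (n : ℕ) (p : Fin n → GraphPath G), Separates G p → N ≤ n) (htwo : 2 ≤ k)
    (hk : IsLeast {j | HasRainbowFamily G N j} k) : chromaticSepNumber G = k := by
  have hN' : ∀ j n, HasRainbowFamily G n j → N ≤ n := fun _ n ⟨p, _, h⟩ => hN n p h.separates
  have hstrong : strongSepNumber G = N := by
    refine le_antisymm (ENat.lt_natCast_add_one_iff.1 ?_) (not_lt.1 fun hlt => ?_)
    · obtain ⟨p, c, h⟩ := hk.1
      exact_mod_cast strongSepNumber_lt_iff.2 ⟨N, N.lt_succ_self, p, h.separates⟩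
    · obtain ⟨m, hm, p, hp⟩ := strongSepNumber_lt_iff.1 hlt
      exact hm.not_ge (hN m p hp)
  have hrainbow (j : ℕ) : rainbowSepNumber G j = N ↔ HasRainbowFamily G N j := by
    rw [le_antisymm_iff, ← ENat.lt_natCast_add_one_iff, ← not_lt (a := rainbowSepNumber G j),
      ← Nat.cast_succ, rainbowSepNumber_lt_iff, rainbowSepNumber_lt_iff]
    constructor
    · rintro ⟨⟨m, hm, h⟩, -⟩
      exact (hN' j m h).antisymm (Nat.lt_succ_iff.1 hm) ▸ h
    · exact fun h => ⟨⟨N, N.lt_succ_self, h⟩, fun ⟨m, hm, h'⟩ => hm.not_ge (hN' j m h')⟩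
  simp only [chromaticSepNumber, hstrong, hrainbow]
  refine le_antisymm (iInf₂_le k ⟨htwo, hk.1⟩) (le_iInf₂ fun j hj => ?_)
  exact_mod_cast hk.2 hj.2

end Families

section PathsThrough

variable {p : ι → GraphPath G} {c : ι → C} {e : Sym2 V} {i j t : ι} {w x y z : V}

/-- The indices of the members of a family of paths that contain a given edge. -/
def pathsThrough (p : ι → GraphPath G) (e : Sym2 V) : Set ι :=
  {t | e ∈ (p t).edges}

theorem mem_pathsThrough : t ∈ pathsThrough p e ↔ e ∈ (p t).edges :=
  Iff.rfl

/-- The vertex `w` has exactly the three neighbours `x`, `y` and `z`. -/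
structure IsCubicAt (G : SimpleGraph V) (w x y z : V) : Prop where
  ne₁₂ : x ≠ y
  ne₁₃ : x ≠ z
  ne₂₃ : y ≠ z
  adj_iff : ∀ t, G.Adj w t ↔ t = x ∨ t = y ∨ t = z

theorem exists_isCubicAt_of_degree_eq_three [Fintype (G.neighborSet w)] (h : G.degree w = 3)
    (hx : G.Adj w x) : ∃ y z, IsCubicAt G w x y z := by
  classical
  rw [← SimpleGraph.mem_neighborFinset] at hx
  have hcard : ((G.neighborFinset w).erase x).card = 2 := by
    rw [Finset.card_erase_of_mem hx, SimpleGraph.card_neighborFinset_eq_degree, h]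
  obtain ⟨y, z, hyz, heq⟩ := Finset.card_eq_two.1 hcard
  have hmem : ∀ t, G.Adj w t ↔ t = x ∨ t = y ∨ t = z := fun t => by
    rw [← SimpleGraph.mem_neighborFinset, ← Finset.insert_erase hx, heq]
    simp
  have hne : ∀ t ∈ ({y, z} : Finset V), x ≠ t := fun t ht =>
    (Finset.ne_of_mem_erase (heq ▸ ht)).symm
  exact ⟨y, z, hne y (by simp), hne z (by simp), hyz, hmem⟩

namespace IsCubicAt

theorem rotate (h : IsCubicAt G w x y z) : IsCubicAt G w y z x :=
  ⟨h.ne₂₃, h.ne₁₂.symm, h.ne₁₃.symm, fun t => by rw [h.adj_iff]; tauto⟩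

theorem swap (h : IsCubicAt G w x y z) : IsCubicAt G w y x z :=
  ⟨h.ne₁₂.symm, h.ne₂₃, h.ne₁₃, fun t => by rw [h.adj_iff]; tauto⟩

theorem adj (h : IsCubicAt G w x y z) : G.Adj w x :=
  (h.adj_iff x).2 (Or.inl rfl)

theorem edge_ne (h : IsCubicAt G w x y z) : s(w, x) ≠ s(w, y) :=
  fun he => h.ne₁₂ (Sym2.congr_right.1 he)

theorem mem_edges_iff_xor {P : GraphPath G} (h : IsCubicAt G w x y z) (hend : ¬ P.IsEnd w) :
    s(w, z) ∈ P.edges ↔ Xor (s(w, x) ∈ P.edges) (s(w, y) ∈ P.edges) := by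
  have hsub : ∀ t, s(w, t) ∈ P.edges → t = x ∨ t = y ∨ t = z := fun t ht =>
    (h.adj_iff t).1 (P.edges_subset_edgeSet ht)
  have hnot : ¬ (s(w, x) ∈ P.edges ∧ s(w, y) ∈ P.edges ∧ s(w, z) ∈ P.edges) := by
    rintro ⟨hx, hy, hz⟩
    have hthree : ({x, y, z} : Set V).ncard = 3 := Set.ncard_eq_three.2
      ⟨x, y, z, h.ne₁₂, h.ne₁₃, h.ne₂₃, rfl⟩
    have hle := Set.ncard_le_ncard (s := {x, y, z}) (t := {t | s(w, t) ∈ P.edges})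
      (by rintro t (rfl | rfl | rfl) <;> assumption) (P.finite_setOf_mk_mem_edges w)
    have := P.ncard_setOf_mk_mem_edges_le_two w
    omega
  have hunique : ∀ t, s(w, t) ∈ P.edges → ∃ u, u ≠ t ∧ s(w, u) ∈ P.edges := by
    by_contra! hcon
    obtain ⟨t, ht, hu⟩ := hcon
    exact hend ⟨t, ht, fun u hmem => not_imp_not.1 (hu u) hmem⟩
  grind [Xor]

theorem pathsThrough_eq_symmDiff (h : IsCubicAt G w x y z) (hend : ∀ t, ¬ (p t).IsEnd w) :
    pathsThrough p s(w, z) = symmDiff (pathsThrough p s(w, x)) (pathsThrough p s(w, y)) :=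
  Set.ext fun t => h.mem_edges_iff_xor (hend t)

theorem color_ne (h : IsCubicAt G w x y z) (hp : RainbowSeparates G p c)
    (hend : ∀ t, ¬ (p t).IsEnd w) (hx : pathsThrough p s(w, x) = {i, j}) : c i ≠ c j := by
  obtain ⟨t, u, hc, ⟨hty, htz⟩, huz, huy⟩ := hp _ h.rotate.adj _ h.rotate.rotate.adj
    h.rotate.edge_ne
  have ht : t = i ∨ t = j := by
    have := (h.rotate.mem_edges_iff_xor (hend t)).2 (Or.inl ⟨hty, htz⟩)
    rwa [← mem_pathsThrough, hx] at this
  have hu : u = i ∨ u = j := by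
    have := (h.rotate.mem_edges_iff_xor (hend u)).2 (Or.inr ⟨huz, huy⟩)
    rwa [← mem_pathsThrough, hx] at this
  grind

theorem ncard_pathsThrough_eq_two (h : IsCubicAt G w x y z) (hp : Separates G p)
    (hend : ∀ t, ¬ (p t).IsEnd w) (hx : (pathsThrough p s(w, x)).ncard = 2)
    (hy : (pathsThrough p s(w, y)).ncard = 2) : (pathsThrough p s(w, z)).ncard = 2 := by
  rw [h.pathsThrough_eq_symmDiff hend]
  set A := pathsThrough p s(w, x)
  set B := pathsThrough p s(w, y)
  have hA : A.Finite := Set.finite_of_ncard_ne_zero (hx ▸ two_ne_zero)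
  have hB : B.Finite := Set.finite_of_ncard_ne_zero (hy ▸ two_ne_zero)
  have hdiff : (A \ B).Nonempty := hp _ h.adj _ h.rotate.adj h.edge_ne
  have hinter : (A ∩ B).Nonempty := by
    obtain ⟨t, htx, htz⟩ := hp _ h.adj _ h.rotate.rotate.adj h.rotate.rotate.edge_ne.symm
    have hty := (h.rotate.rotate.mem_edges_iff_xor (hend t)).2 (Or.inr ⟨htx, htz⟩)
    exact ⟨t, htx, hty⟩
  have hdiff_pos := (Set.ncard_pos (hA.subset Set.sdiff_subset)).2 hdiff
  have hinter_pos := (Set.ncard_pos (hA.subset Set.inter_subset_left)).2 hinter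
  have hsumA := Set.ncard_inter_add_ncard_sdiff_eq_ncard A B hA
  have hsumB := Set.ncard_inter_add_ncard_sdiff_eq_ncard B A hB
  rw [Set.inter_comm] at hsumB
  rw [Set.symmDiff_def, Set.ncard_union_eq disjoint_sdiff_sdiff (hA.subset Set.sdiff_subset)
    (hB.subset Set.sdiff_subset)]
  omega

end IsCubicAt

theorem RainbowSeparates.card_le_card_colors [Fintype C] (hp : RainbowSeparates G p c)
    {S : Finset (Sym2 V)} (hS : ∀ e ∈ S, e ∈ (p i).edges ∧ (pathsThrough p e).ncard = 2) :
    S.card ≤ Fintype.card C := by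
  have hother : ∀ e ∈ S, ∃ o, pathsThrough p e = {i, o} := by
    intro e he
    obtain ⟨a, b, -, hab⟩ := Set.ncard_eq_two.1 (hS e he).2
    have hi : i ∈ pathsThrough p e := (hS e he).1
    rw [hab] at hi
    obtain rfl | rfl := hi
    · exact ⟨b, hab⟩
    · exact ⟨a, hab.trans (Set.pair_comm _ _)⟩
  have : Nonempty ι := ⟨i⟩
  choose! o ho using hother
  refine Finset.card_le_card_of_injOn (c ∘ o) (by simp) fun e he g hg hc => ?_
  by_contra hne
  obtain ⟨t, u, htu, ⟨hte, htg⟩, hug, hue⟩ := hp e ((p i).edges_subset_edgeSet (hS e he).1) g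
    ((p i).edges_subset_edgeSet (hS g hg).1) hne
  have ht : t = o e := by
    rw [← mem_pathsThrough, ho e he] at hte
    exact hte.resolve_left fun h => htg (h ▸ (hS g hg).1)
  have hu : u = o g := by
    rw [← mem_pathsThrough, ho g hg] at hug
    exact hug.resolve_left fun h => hue (h ▸ (hS e he).1)
  exact htu (ht ▸ hu ▸ hc)

end PathsThrough

section Counting

variable [Fintype V] [DecidableRel G.Adj] [Fintype ι] {P : GraphPath G} {p : ι → GraphPath G}
  {v w : V}

/-- The vertices of degree at most two. In the graphs considered here their number is the least
size of a separating family of paths. -/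
def lowDegree (G : SimpleGraph V) [DecidableRel G.Adj] : Finset V :=
  {v | G.degree v ≤ 2}

/-- There are no isolated vertices, every leaf is attached to a vertex of degree three, and every
vertex of degree three has a neighbour that is not a leaf. -/
structure IsLeafCubic (G : SimpleGraph V) [DecidableRel G.Adj] : Prop where
  degree_pos (v : V) : 0 < G.degree v
  degree_eq_three {v w : V} (hv : G.degree v = 1) (hvw : G.Adj v w) : G.degree w = 3
  exists_nonleaf {w : V} (hw : G.degree w = 3) : ∃ x, G.Adj w x ∧ G.degree x ≠ 1

/-- The vertex `v` is a leaf and the edge at `v` is the only edge of the path. -/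
def GraphPath.IsLeafEdge (P : GraphPath G) (v : V) : Prop :=
  G.degree v = 1 ∧ ∃ w, P.edges = {s(v, w)}

open Classical in
/-- The share of a path in covering the vertex `v`: one if `v` is an end of the path, and one more
if the path consists of the edge at the leaf `v`. -/
noncomputable def GraphPath.charge (P : GraphPath G) (v : V) : ℕ :=
  (if P.IsEnd v then 1 else 0) + if P.IsLeafEdge v then 1 else 0

theorem mem_lowDegree : v ∈ lowDegree G ↔ G.degree v ≤ 2 := by
  simp [lowDegree]

theorem GraphPath.isEnd_of_degree_eq_one (hv : G.degree v = 1) (hw : s(v, w) ∈ P.edges) :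
    P.IsEnd v :=
  isEnd_of_existsUnique_adj (SimpleGraph.degree_eq_one_iff_existsUnique_adj.1 hv)
    (Sym2.mem_mk_left v w) hw

theorem GraphPath.IsEnd.one_le_charge (h : P.IsEnd v) : 1 ≤ P.charge v := by
  simp [charge, h]

theorem GraphPath.IsLeafEdge.isEnd (h : P.IsLeafEdge v) : P.IsEnd v := by
  obtain ⟨hv, w, hw⟩ := h
  exact isEnd_of_degree_eq_one hv (w := w) (by simp [hw])

theorem GraphPath.IsLeafEdge.charge_eq_two (h : P.IsLeafEdge v) : P.charge v = 2 := by
  simp [charge, h, h.isEnd]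

open Classical in
theorem GraphPath.sum_charge_eq_card_ends (hP : ∀ v, ¬ P.IsLeafEdge v) :
    ∑ v ∈ lowDegree G, P.charge v = {v ∈ lowDegree G | P.IsEnd v}.card := by
  simp [charge, hP]

theorem two_le_sum_of_ne {f : ι → ℕ} {i j : ι} (hij : i ≠ j) (hi : 1 ≤ f i) (hj : 1 ≤ f j) :
    2 ≤ ∑ t, f t :=
  (add_le_add hi hj).trans
    (Finset.add_le_sum (fun _ _ => zero_le) (Finset.mem_univ i) (Finset.mem_univ j) hij)

namespace IsLeafCubic

theorem exists_isCubicAt (hG : IsLeafCubic G) (hv : G.degree v = 1) (hvw : G.Adj v w) :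
    ∃ x y, IsCubicAt G w v x y :=
  exists_isCubicAt_of_degree_eq_three (hG.degree_eq_three hv hvw) hvw.symm

theorem sum_charge_le_two (hG : IsLeafCubic G) (P : GraphPath G) :
    ∑ v ∈ lowDegree G, P.charge v ≤ 2 := by
  classical
  by_cases hP : ∃ v, P.IsLeafEdge v
  · obtain ⟨v, h⟩ := hP
    have hzero : ∀ u ∈ lowDegree G, u ≠ v → P.charge u = 0 := by
      intro u hu huv
      obtain ⟨hv, w, hw⟩ := h
      have hmem : s(v, w) ∈ P.edges := by simp [hw]
      have hvw : G.Adj v w := P.edges_subset_edgeSet hmem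
      have huw : u ≠ w := by
        rintro rfl
        have := hG.degree_eq_three hv hvw
        have := mem_lowDegree.1 hu
        omega
      have hend : ¬ P.IsEnd u := fun ⟨x, hx, _⟩ => by simp_all
      have hleaf : ¬ P.IsLeafEdge u := fun h' => hend h'.isEnd
      simp [GraphPath.charge, hend, hleaf]
    have hv : v ∈ lowDegree G := mem_lowDegree.2 (h.1.le.trans one_le_two)
    rw [Finset.sum_eq_single_of_mem v hv hzero, h.charge_eq_two]
  · rw [P.sum_charge_eq_card_ends (not_exists.1 hP)]
    exact P.card_le_two_of_forall_isEnd (by simp)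

theorem exists_edges_eq_singleton (hP : 2 ≤ ∑ v ∈ lowDegree G, P.charge v)
    (hw : G.degree w = 3) (hend : P.IsEnd w) : ∃ v, G.degree v = 1 ∧ P.edges = {s(w, v)} := by
  classical
  by_cases hleaf : ∃ v, P.IsLeafEdge v
  · obtain ⟨v, hv, u, hu⟩ := hleaf
    obtain ⟨x, hx, -⟩ := hend
    have hwv : w ≠ v := by
      rintro rfl
      omega
    obtain rfl : w = u := by
      simp only [hu, Set.mem_singleton_iff, Sym2.eq_iff] at hx
      tauto
    exact ⟨v, hv, hu.trans (by rw [Sym2.eq_swap])⟩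
  · rw [P.sum_charge_eq_card_ends (not_exists.1 hleaf)] at hP
    have hnot : w ∉ {v ∈ lowDegree G | P.IsEnd v} := by simp [mem_lowDegree, hw]
    have hcard := P.card_le_two_of_forall_isEnd (s := insert w {v ∈ lowDegree G | P.IsEnd v})
      (by simp [hend])
    rw [Finset.card_insert_of_notMem hnot] at hcard
    omega

theorem two_le_sum_charge_of_degree_eq_one (hG : IsLeafCubic G) (hp : Separates G p)
    (hv : G.degree v = 1) : 2 ≤ ∑ t, (p t).charge v := by
  obtain ⟨w, hvw⟩ := (G.degree_pos_iff_exists_adj v).1 (hG.degree_pos v)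
  obtain ⟨x, y, hw⟩ := hG.exists_isCubicAt hv hvw
  obtain ⟨i, hi, -⟩ := hp _ hw.adj _ hw.rotate.adj hw.edge_ne
  rw [Sym2.eq_swap] at hi
  by_cases hleaf : (p i).IsLeafEdge v
  · exact hleaf.charge_eq_two.ge.trans
      (Finset.single_le_sum (f := fun t => (p t).charge v) (fun _ _ => zero_le)
        (Finset.mem_univ i))
  · obtain ⟨g, hg, hne⟩ : ∃ g ∈ (p i).edges, g ≠ s(v, w) := by
      by_contra! h
      exact hleaf ⟨hv, w, Set.eq_singleton_iff_unique_mem.2 ⟨hi, h⟩⟩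
    obtain ⟨j, hj, hgj⟩ := hp _ hvw _ ((p i).edges_subset_edgeSet hg) hne.symm
    have hij : i ≠ j := fun h => hgj (h ▸ hg)
    exact two_le_sum_of_ne hij (GraphPath.isEnd_of_degree_eq_one hv hi).one_le_charge
      (GraphPath.isEnd_of_degree_eq_one hv hj).one_le_charge

theorem two_le_sum_charge_of_degree_eq_two (hp : Separates G p) (hv : G.degree v = 2) :
    2 ≤ ∑ t, (p t).charge v := by
  classical
  obtain ⟨x, y, hxy, hmem⟩ := Finset.card_eq_two.1 (G.card_neighborFinset_eq_degree v ▸ hv)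
  have hadj : ∀ t, G.Adj v t ↔ t = x ∨ t = y := fun t => by
    rw [← SimpleGraph.mem_neighborFinset, hmem]
    simp
  have hne : s(v, x) ≠ s(v, y) := fun h => hxy (Sym2.congr_right.1 h)
  obtain ⟨i, hix, hiy⟩ := hp _ ((hadj x).2 (.inl rfl)) _ ((hadj y).2 (.inr rfl)) hne
  obtain ⟨j, hjy, hjx⟩ := hp _ ((hadj y).2 (.inr rfl)) _ ((hadj x).2 (.inl rfl)) hne.symm
  have hij : i ≠ j := fun h => hjx (h ▸ hix)
  have hi : (p i).IsEnd v := ⟨x, hix, fun t ht =>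
    ((hadj t).1 ((p i).edges_subset_edgeSet ht)).resolve_right fun h => hiy (h ▸ ht)⟩
  have hj : (p j).IsEnd v := ⟨y, hjy, fun t ht =>
    ((hadj t).1 ((p j).edges_subset_edgeSet ht)).resolve_left fun h => hjx (h ▸ ht)⟩
  exact two_le_sum_of_ne hij hi.one_le_charge hj.one_le_charge

theorem two_le_sum_charge (hG : IsLeafCubic G) (hp : Separates G p) (hv : v ∈ lowDegree G) :
    2 ≤ ∑ t, (p t).charge v := by
  have hpos := hG.degree_pos v
  have hle := mem_lowDegree.1 hv
  obtain hone | htwo : G.degree v = 1 ∨ G.degree v = 2 := by omega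
  · exact hG.two_le_sum_charge_of_degree_eq_one hp hone
  · exact two_le_sum_charge_of_degree_eq_two hp htwo

theorem card_lowDegree_le (hG : IsLeafCubic G) (hp : Separates G p) :
    (lowDegree G).card ≤ Fintype.card ι := by
  refine Nat.le_of_mul_le_mul_right ?_ two_pos
  calc
    (lowDegree G).card * 2 ≤ ∑ v ∈ lowDegree G, ∑ t, (p t).charge v :=
      Finset.card_nsmul_le_sum _ _ _ fun _ hv => hG.two_le_sum_charge hp hv
    _ = ∑ t, ∑ v ∈ lowDegree G, (p t).charge v := Finset.sum_comm
    _ ≤ Fintype.card ι * 2 := Finset.sum_le_card_nsmul _ _ _ fun t _ => hG.sum_charge_le_two (p t)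

theorem sum_charge_eq_two (hG : IsLeafCubic G) (hp : Separates G p)
    (hcard : Fintype.card ι = (lowDegree G).card) :
    (∀ v ∈ lowDegree G, ∑ t, (p t).charge v = 2) ∧
      ∀ t, ∑ v ∈ lowDegree G, (p t).charge v = 2 := by
  have hvertex : ∀ v ∈ lowDegree G, 2 ≤ ∑ t, (p t).charge v := fun v hv =>
    hG.two_le_sum_charge hp hv
  have hpath : ∀ t ∈ Finset.univ, ∑ v ∈ lowDegree G, (p t).charge v ≤ 2 := fun t _ =>
    hG.sum_charge_le_two (p t)
  have hcomm := Finset.sum_comm (s := lowDegree G) (t := Finset.univ)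
    (f := fun v t => (p t).charge v)
  have hconst : ∑ v ∈ lowDegree G, 2 = ∑ t : ι, 2 := by simp [hcard]
  have hle := Finset.sum_le_sum hvertex
  have hge := Finset.sum_le_sum hpath
  exact ⟨fun v hv => ((Finset.sum_eq_sum_iff_of_le hvertex).1 (by omega) v hv).symm,
    fun t => (Finset.sum_eq_sum_iff_of_le hpath).1 (by omega) t (Finset.mem_univ t)⟩

theorem eq_of_isLeafEdge (hG : IsLeafCubic G) (hp : Separates G p)
    (hcard : Fintype.card ι = (lowDegree G).card) {i j : ι} (hi : (p i).IsLeafEdge v)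
    (hj : s(v, w) ∈ (p j).edges) : j = i := by
  by_contra hne
  have hle := Finset.add_le_sum (f := fun t => (p t).charge v) (fun _ _ => zero_le)
    (Finset.mem_univ j) (Finset.mem_univ i) hne
  rw [(hG.sum_charge_eq_two hp hcard).1 v (mem_lowDegree.2 (hi.1.le.trans one_le_two)),
    hi.charge_eq_two] at hle
  have := (GraphPath.isEnd_of_degree_eq_one hi.1 hj).one_le_charge
  omega

theorem degree_eq_one_of_isLeafEdge (hG : IsLeafCubic G) (hp : Separates G p)
    (hcard : Fintype.card ι = (lowDegree G).card) {i : ι} {x y : V} (hi : (p i).IsLeafEdge v)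
    (hvw : s(v, w) ∈ (p i).edges) (h : IsCubicAt G w v x y) : G.degree x = 1 := by
  obtain ⟨j, hj, hj'⟩ := hp _ h.rotate.adj _ h.rotate.rotate.adj h.rotate.edge_ne
  have hjv : s(w, v) ∉ (p j).edges := by
    intro hmem
    obtain rfl := hG.eq_of_isLeafEdge hp hcard hi (Sym2.eq_swap ▸ hmem)
    obtain ⟨-, u, hu⟩ := hi
    rw [hu, Set.mem_singleton_iff] at hj hmem
    exact h.edge_ne (hmem.trans hj.symm)
  have hend : (p j).IsEnd w := ⟨x, hj, fun t ht => by
    rcases (h.adj_iff t).1 ((p j).edges_subset_edgeSet ht) with rfl | rfl | rfl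
    exacts [absurd ht hjv, rfl, absurd ht hj']⟩
  have hw := hG.degree_eq_three hi.1 ((p i).edges_subset_edgeSet hvw)
  obtain ⟨u, hu, hedge⟩ := exists_edges_eq_singleton ((hG.sum_charge_eq_two hp hcard).2 j).ge
    hw hend
  rw [hedge, Set.mem_singleton_iff, Sym2.congr_right] at hj
  exact hj ▸ hu

theorem not_isLeafEdge (hG : IsLeafCubic G) (hp : Separates G p)
    (hcard : Fintype.card ι = (lowDegree G).card) (i : ι) (v : V) : ¬ (p i).IsLeafEdge v := by
  intro hi
  obtain ⟨w, hw⟩ := hi.2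
  have hmem : s(v, w) ∈ (p i).edges := by simp [hw]
  have hvw : G.Adj v w := (p i).edges_subset_edgeSet hmem
  obtain ⟨x, y, h⟩ := hG.exists_isCubicAt hi.1 hvw
  obtain ⟨t, ht, hne⟩ := hG.exists_nonleaf (hG.degree_eq_three hi.1 hvw)
  rcases (h.adj_iff t).1 ht with rfl | rfl | rfl
  exacts [hne hi.1, hne (hG.degree_eq_one_of_isLeafEdge hp hcard hi hmem h),
    hne (hG.degree_eq_one_of_isLeafEdge hp hcard hi hmem h.swap.rotate)]

theorem not_isEnd (hG : IsLeafCubic G) (hp : Separates G p)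
    (hcard : Fintype.card ι = (lowDegree G).card) (hw : G.degree w = 3) (t : ι) :
    ¬ (p t).IsEnd w := fun hend => by
  obtain ⟨v, hv, hedge⟩ := exists_edges_eq_singleton ((hG.sum_charge_eq_two hp hcard).2 t).ge
    hw hend
  exact hG.not_isLeafEdge hp hcard t v ⟨hv, w, hedge.trans (by rw [Sym2.eq_swap])⟩

theorem ncard_pathsThrough_eq_two (hG : IsLeafCubic G) (hp : Separates G p)
    (hcard : Fintype.card ι = (lowDegree G).card) (hv : G.degree v = 1) (hvw : G.Adj v w) :
    (pathsThrough p s(v, w)).ncard = 2 := by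
  classical
  have hends : ∀ t, s(v, w) ∈ (p t).edges ↔ (p t).IsEnd v := by
    refine fun t => ⟨GraphPath.isEnd_of_degree_eq_one hv, fun ⟨x, hx, _⟩ => ?_⟩
    have hunique := SimpleGraph.degree_eq_one_iff_existsUnique_adj.1 hv
    rwa [hunique.unique hvw ((p t).edges_subset_edgeSet hx)]
  rw [← (hG.sum_charge_eq_two hp hcard).1 v (mem_lowDegree.2 (by omega))]
  simp [GraphPath.charge, hG.not_isLeafEdge hp hcard, ← hends, pathsThrough,
    Set.ncard_eq_toFinset_card']

end IsLeafCubic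

end Counting

section Fork

variable {f : G →g G'} {l : V} {a b : V'} {p : ι → GraphPath G} {p' : Option ι → GraphPath G'}
  {c : ι → C} {κ : C} {e : Sym2 V} {i j : ι}

/-- The graph `G'` arises from the image of `G` under `f` by attaching two new leaves `a` and `b`
to the image of the vertex `l`. -/
structure IsFork (f : G →g G') (l : V) (a b : V') : Prop where
  injective : Function.Injective f
  ne : a ≠ b
  left_notMem : a ∉ Set.range f
  right_notMem : b ∉ Set.range f
  left_adj : G'.Adj a (f l)
  right_adj : G'.Adj b (f l)
  edge_cases : ∀ e ∈ G'.edgeSet, (∃ g ∈ G.edgeSet, g.map f = e) ∨ e = s(a, f l) ∨ e = s(b, f l)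

/-- The family `p'` arises from `p` by prolonging the paths `i` and `j` from `l` to the new leaves
`a` and `b` respectively, and by adding the path from `a` to `b` under the index `none`. -/
structure IsForkFamily (f : G →g G') (l : V) (a b : V') (p : ι → GraphPath G) (i j : ι)
    (p' : Option ι → GraphPath G') : Prop where
  map_mem_some_iff (g : Sym2 V) (t : ι) : g.map f ∈ (p' (some t)).edges ↔ g ∈ (p t).edges
  map_notMem_none (g : Sym2 V) : g.map f ∉ (p' none).edges
  left_mem_iff (t : Option ι) : s(a, f l) ∈ (p' t).edges ↔ t = none ∨ t = some i
  right_mem_iff (t : Option ι) : s(b, f l) ∈ (p' t).edges ↔ t = none ∨ t = some j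

/-- The edge `e` lies in exactly the paths `i` and `j`, their colours and `κ` are distinct, and
every other edge lies in a path that avoids `e` and is not of colour `κ`. Then a fork at a common
end of the two paths can be covered by prolonging them and adding a path of colour `κ`. -/
structure IsForkable (p : ι → GraphPath G) (c : ι → C) (κ : C) (e : Sym2 V) (i j : ι) : Prop where
  pathsThrough_eq : pathsThrough p e = {i, j}
  color_ne : c i ≠ c j
  left_ne : c i ≠ κ
  right_ne : c j ≠ κ
  exists_avoiding : ∀ g ∈ G.edgeSet, g ≠ e → ∃ t, g ∈ (p t).edges ∧ e ∉ (p t).edges ∧ c t ≠ κ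

theorem map_ne_mk_of_notMem_range {g : Sym2 V} {x y : V'} (hx : x ∉ Set.range f) :
    g.map f ≠ s(x, y) := by
  intro h
  obtain ⟨z, -, hz⟩ := Sym2.mem_map.1 (h ▸ Sym2.mem_mk_left x y)
  exact hx ⟨z, hz⟩

theorem IsFork.symm (h : IsFork f l a b) : IsFork f l b a :=
  ⟨h.injective, h.ne.symm, h.right_notMem, h.left_notMem, h.right_adj, h.left_adj,
    fun e he => (h.edge_cases e he).imp_right Or.symm⟩

theorem IsFork.edge_ne (h : IsFork f l a b) : s(a, f l) ≠ s(b, f l) :=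
  fun he => h.ne (Sym2.congr_left.1 he)

theorem IsForkFamily.symm (h : IsForkFamily f l a b p i j p') : IsForkFamily f l b a p j i p' :=
  ⟨h.map_mem_some_iff, h.map_notMem_none, h.right_mem_iff, h.left_mem_iff⟩

theorem IsForkable.ne (h : IsForkable p c κ e i j) : i ≠ j :=
  ne_of_apply_ne c h.color_ne

theorem IsForkable.symm (h : IsForkable p c κ e i j) : IsForkable p c κ e j i :=
  ⟨h.pathsThrough_eq.trans (Set.pair_comm i j), h.color_ne.symm, h.right_ne, h.left_ne,
    h.exists_avoiding⟩

theorem IsFork.exists_prolongation (h : IsFork f l a b) (hij : i ≠ j) (hi : (p i).IsEnd l)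
    (hj : (p j).IsEnd l) (t : ι) : ∃ P : GraphPath G', ∀ g, g ∈ P.edges ↔
      g ∈ Sym2.map f '' (p t).edges ∨ (t = i ∧ g = s(a, f l)) ∨ (t = j ∧ g = s(b, f l)) := by
  by_cases hti : t = i
  · subst hti
    obtain ⟨P, hP⟩ := hi.exists_edges_eq_insert h.injective h.left_notMem h.left_adj
    exact ⟨P, fun g => by simp [hP, hij, or_comm]⟩
  by_cases htj : t = j
  · subst htj
    obtain ⟨P, hP⟩ := hj.exists_edges_eq_insert h.injective h.right_notMem h.right_adj
    exact ⟨P, fun g => by simp [hP, hti, or_comm]⟩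
  · obtain ⟨P, hP⟩ := (p t).exists_edges_eq_image h.injective
    exact ⟨P, fun g => by simp [hP, hti, htj]⟩

theorem IsFork.exists_isForkFamily (h : IsFork f l a b) (hij : i ≠ j) (hi : (p i).IsEnd l)
    (hj : (p j).IsEnd l) :
    ∃ p' : Option ι → GraphPath G', IsForkFamily f l a b p i j p' := by
  choose P hP using h.exists_prolongation hij hi hj
  obtain ⟨R, hR⟩ := GraphPath.exists_edges_eq_pair h.left_adj h.right_adj.symm h.ne
  have hleft : ∀ g : Sym2 V, g.map f ≠ s(a, f l) := fun _ =>
    map_ne_mk_of_notMem_range h.left_notMem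
  have hright : ∀ g : Sym2 V, g.map f ≠ s(b, f l) := fun _ =>
    map_ne_mk_of_notMem_range h.right_notMem
  refine ⟨fun t => t.elim R P, fun g t => ?_, fun g => ?_, fun t => ?_, fun t => ?_⟩
  · simp [hP, hleft, hright, (Sym2.map.injective h.injective).eq_iff]
  · simp [hR, hleft, Sym2.eq_swap (a := f l), hright]
  · cases t <;> simp [hR, hP, hleft, h.edge_ne]
  · cases t <;> simp [hR, hP, hright, h.edge_ne.symm, Sym2.eq_swap (a := f l)]

theorem IsForkable.exists_ne (h : IsForkable p c κ e i j) {g : Sym2 V} (hg : g ∈ G.edgeSet) :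
    ∃ t, t ≠ i ∧ g ∈ (p t).edges ∧ c t ≠ κ := by
  have hmem : ∀ t, e ∈ (p t).edges ↔ t = i ∨ t = j := fun t => by
    rw [← mem_pathsThrough, h.pathsThrough_eq]
    rfl
  by_cases hge : g = e
  · subst hge
    exact ⟨j, h.ne.symm, (hmem j).2 (Or.inr rfl), h.right_ne⟩
  · obtain ⟨t, hgt, het, ht⟩ := h.exists_avoiding g hg hge
    exact ⟨t, fun hti => het ((hmem t).2 (Or.inl hti)), hgt, ht⟩

theorem IsForkFamily.isRainbowSeparated_map_left (h : IsForkFamily f l a b p i j p')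
    (hc : IsForkable p c κ e i j) {g : Sym2 V} (hg : g ∈ G.edgeSet) :
    IsRainbowSeparated p' (fun t => t.elim κ c) (g.map f) s(a, f l) := by
  obtain ⟨t, hti, hgt, ht⟩ := hc.exists_ne hg
  exact ⟨some t, none, ht, ⟨(h.map_mem_some_iff g t).2 hgt, by simpa [h.left_mem_iff] using hti⟩,
    (h.left_mem_iff none).2 (Or.inl rfl), h.map_notMem_none g⟩

theorem IsForkFamily.rainbowSeparates (h : IsForkFamily f l a b p i j p') (hf : IsFork f l a b)
    (hp : RainbowSeparates G p c) (hc : IsForkable p c κ e i j) :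
    RainbowSeparates G' p' (fun t => t.elim κ c) := by
  have hij := hc.ne
  have hleft {g} (hg : g ∈ G.edgeSet) := h.isRainbowSeparated_map_left hc hg
  have hright {g} (hg : g ∈ G.edgeSet) := h.symm.isRainbowSeparated_map_left hc.symm hg
  have hnew : IsRainbowSeparated p' (fun t => t.elim κ c) s(a, f l) s(b, f l) :=
    ⟨some i, some j, hc.color_ne, by simpa [h.left_mem_iff, h.right_mem_iff] using hij,
      by simpa [h.left_mem_iff, h.right_mem_iff] using hij.symm⟩
  intro x hx y hy hxy
  obtain ⟨g, hg, rfl⟩ | rfl | rfl := hf.edge_cases x hx <;>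
    obtain ⟨g', hg', rfl⟩ | rfl | rfl := hf.edge_cases y hy
  · obtain ⟨t, u, htu, hsep⟩ := hp g hg g' hg' (fun heq => hxy (heq ▸ rfl))
    exact ⟨some t, some u, htu, by simpa only [h.map_mem_some_iff] using hsep⟩
  · exact hleft hg
  · exact hright hg
  · exact (hleft hg').symm
  · exact absurd rfl hxy
  · exact hnew
  · exact (hright hg').symm
  · exact hnew.symm
  · exact absurd rfl hxy

theorem IsForkFamily.isForkable_map (h : IsForkFamily f l a b p i j p') (hf : IsFork f l a b)
    (hi : c i ≠ κ) (hj : c j ≠ κ) {e' : Sym2 V} {i' j' : ι} (hc : IsForkable p c κ e' i' j')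
    (hie : e' ∉ (p i).edges) (hje : e' ∉ (p j).edges) :
    IsForkable p' (fun t => t.elim κ c) κ (e'.map f) (some i') (some j') := by
  refine ⟨?_, hc.color_ne, hc.left_ne, hc.right_ne, fun x hx hne => ?_⟩
  · ext (_ | t)
    · simp [mem_pathsThrough, h.map_notMem_none]
    · rw [mem_pathsThrough, h.map_mem_some_iff, ← mem_pathsThrough, hc.pathsThrough_eq]
      simp
  · obtain ⟨g, hg, rfl⟩ | rfl | rfl := hf.edge_cases x hx
    · obtain ⟨t, hgt, het, ht⟩ := hc.exists_avoiding g hg (fun heq => hne (heq ▸ rfl))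
      exact ⟨some t, (h.map_mem_some_iff g t).2 hgt, by rwa [h.map_mem_some_iff], ht⟩
    · exact ⟨some i, (h.left_mem_iff _).2 (Or.inr rfl), by rwa [h.map_mem_some_iff], hi⟩
    · exact ⟨some j, (h.right_mem_iff _).2 (Or.inr rfl), by rwa [h.map_mem_some_iff], hj⟩

theorem RainbowSeparates.isForkable_fresh (hp : RainbowSeparates G p c) (he : e ∈ G.edgeSet)
    (hij : pathsThrough p e = {i, j}) (hc : c i ≠ c j) :
    IsForkable p (some ∘ c) none e i j where
  pathsThrough_eq := hij
  color_ne := by simpa using hc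
  left_ne := by simp
  right_ne := by simp
  exists_avoiding g hg hne := let ⟨t, ht, ht'⟩ := hp.separates g hg e he hne; ⟨t, ht, ht', by simp⟩

theorem IsFork.hasRainbowFamily [Fintype ι] [Fintype C] (hf : IsFork f l a b)
    (hp : RainbowSeparates G p c) (he : e ∈ G.edgeSet) (hij : pathsThrough p e = {i, j})
    (hc : c i ≠ c j) (hi : (p i).IsEnd l) (hj : (p j).IsEnd l) :
    HasRainbowFamily G' (Fintype.card ι + 1) (Fintype.card C + 1) := by
  obtain ⟨p', hp'⟩ := hf.exists_isForkFamily (ne_of_apply_ne c hc) hi hj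
  simpa using (hp'.rainbowSeparates hf (hp.comp_injective (Option.some_injective C))
    (hp.isForkable_fresh he hij hc)).hasRainbowFamily

end Fork

section ParentGraph

variable {q : ℕ → ℕ} {n m : ℕ}

/-- The graph on `{0, …, n}` in which every vertex `e + 1` is joined to its parent `q e`. It is
meant for functions with `q e ≤ e`, for which it is a tree rooted at `0`, and the vertices `e + 1`
correspond to the edges. -/
def parentGraph (q : ℕ → ℕ) (n : ℕ) : SimpleGraph (Fin (n + 1)) :=
  SimpleGraph.fromRel fun x y => y ≠ 0 ∧ q (y - 1) = x

instance : DecidableRel (parentGraph q n).Adj :=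
  inferInstanceAs (DecidableRel (SimpleGraph.fromRel _).Adj)

/-- The edge of `parentGraph q n` that joins `e + 1` to its parent. -/
def parentEdge (hq : ∀ e, q e ≤ e) (e : Fin n) : Sym2 (Fin (n + 1)) :=
  s(e.succ, ⟨q e, Nat.lt_succ_of_le ((hq e).trans e.is_le')⟩)

theorem parentGraph_adj_iff (hq : ∀ e, q e ≤ e) {x y : Fin (n + 1)} : (parentGraph q n).Adj x y ↔
    (y.val ≠ 0 ∧ q (y - 1) = x) ∨ (x.val ≠ 0 ∧ q (x - 1) = y) := by
  rw [parentGraph, SimpleGraph.fromRel_adj]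
  simp only [ne_eq, Fin.ext_iff, Fin.val_zero]
  refine and_iff_right_of_imp fun h heq => ?_
  have hx := hq (x - 1)
  rw [← heq] at h
  omega

theorem parentEdge_eq_mk_iff (hq : ∀ e, q e ≤ e) {e : Fin n} {x y : Fin (n + 1)} :
    parentEdge hq e = s(x, y) ↔
      (e + 1 = x.val ∧ q e = y) ∨ (e + 1 = y.val ∧ q e = x) := by
  simp [parentEdge, Fin.ext_iff]

theorem edgeSet_parentGraph (hq : ∀ e, q e ≤ e) :
    (parentGraph q n).edgeSet = Set.range (parentEdge hq) := by
  ext e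
  induction e with
  | _ x y =>
    simp only [SimpleGraph.mem_edgeSet, parentGraph_adj_iff hq, Set.mem_range,
      parentEdge_eq_mk_iff]
    constructor
    · rintro (⟨h, hxy⟩ | ⟨h, hxy⟩)
      · exact ⟨⟨y - 1, by omega⟩, Or.inr ⟨Nat.succ_pred h, hxy⟩⟩
      · exact ⟨⟨x - 1, by omega⟩, Or.inl ⟨Nat.succ_pred h, hxy⟩⟩
    · rintro ⟨e, ⟨hx, hy⟩ | ⟨hy, hx⟩⟩
      · exact Or.inr ⟨by omega, by rw [← hx, ← hy, Nat.add_sub_cancel]⟩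
      · exact Or.inl ⟨by omega, by rw [← hy, ← hx, Nat.add_sub_cancel]⟩

theorem parentEdge_injective (hq : ∀ e, q e ≤ e) :
    Function.Injective (parentEdge hq : Fin n → Sym2 (Fin (n + 1))) := by
  intro e g h
  have he := hq e
  have hg := hq g
  rw [parentEdge, eq_comm, parentEdge_eq_mk_iff] at h
  simp only [Fin.val_succ] at h
  omega

theorem connected_parentGraph (hq : ∀ e, q e ≤ e) : (parentGraph q n).Connected := by
  have hroot : ∀ x : ℕ, ∀ hx : x < n + 1, (parentGraph q n).Reachable ⟨x, hx⟩ 0 := by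
    intro x
    induction x using Nat.strong_induction_on with
    | _ x ih =>
      intro hx
      obtain _ | x := x
      · rfl
      · have hle := hq x
        refine SimpleGraph.Reachable.trans (SimpleGraph.Adj.reachable ?_)
          (ih (q x) (by omega) (by omega))
        exact (parentGraph_adj_iff hq).2 (Or.inr ⟨x.succ_ne_zero, rfl⟩)
  exact ⟨fun x y => (hroot x x.2).trans (hroot y y.2).symm⟩

theorem isTree_parentGraph (hq : ∀ e, q e ≤ e) : (parentGraph q n).IsTree := by
  rw [SimpleGraph.isTree_iff_connected_and_card]
  refine ⟨connected_parentGraph hq, ?_⟩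
  rw [edgeSet_parentGraph hq, Nat.card_range_of_injective (parentEdge_injective hq)]
  simp

theorem mem_parentEdge_iff (hq : ∀ e, q e ≤ e) {e : Fin n} {v : Fin (n + 1)} :
    v ∈ parentEdge hq e ↔ e + 1 = v.val ∨ q e = v := by
  simp [parentEdge, Fin.ext_iff, eq_comm]

theorem parentEdge_mem_incidenceSet_iff (hq : ∀ e, q e ≤ e) {e : Fin n} {v : Fin (n + 1)} :
    parentEdge hq e ∈ (parentGraph q n).incidenceSet v ↔ e + 1 = v.val ∨ q e = v := by
  rw [SimpleGraph.incidenceSet, edgeSet_parentGraph hq]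
  exact (and_iff_right (Set.mem_range_self e)).trans (mem_parentEdge_iff hq)

theorem degree_parentGraph (hq : ∀ e, q e ≤ e) (v : Fin (n + 1)) :
    (parentGraph q n).degree v = {e ∈ Finset.range n | e + 1 = v.val ∨ q e = v}.card := by
  have himage : (parentGraph q n).incidenceFinset v =
      ({e | e + 1 = v.val ∨ q e = v} : Finset (Fin n)).map
        ⟨parentEdge hq, parentEdge_injective hq⟩ := by
    ext e
    rw [SimpleGraph.mem_incidenceFinset, Finset.mem_map]
    simp only [Finset.mem_filter_univ, ← parentEdge_mem_incidenceSet_iff hq]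
    refine ⟨fun he => ?_, by rintro ⟨e, he, rfl⟩; exact he⟩
    obtain ⟨e, rfl⟩ := edgeSet_parentGraph hq ▸ he.1
    exact ⟨e, he, rfl⟩
  rw [← SimpleGraph.card_incidenceFinset_eq_degree, himage, Finset.card_map, Finset.card_filter,
    Finset.card_filter]
  exact Fin.sum_univ_eq_sum_range (fun e => if e + 1 = v.val ∨ q e = v then 1 else 0) n

/-- The inclusion of the subtree on `{0, …, n}`. -/
def parentGraphHom (hq : ∀ e, q e ≤ e) (h : n ≤ m) : parentGraph q n →g parentGraph q m where
  toFun := Fin.castLE (Nat.succ_le_succ h)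
  map_rel' := by simp [parentGraph_adj_iff hq]

theorem map_parentEdge (hq : ∀ e, q e ≤ e) (h : n ≤ m) (e : Fin n) :
    (parentEdge hq e).map (parentGraphHom hq h) = parentEdge hq (e.castLE h) :=
  rfl

theorem isFork_parentGraphHom (hq : ∀ e, q e ≤ e) {l : Fin (n + 1)} (hn : q n = l)
    (hn' : q (n + 1) = l) :
    IsFork (parentGraphHom hq (Nat.le_add_right n 2)) l ⟨n + 1, by omega⟩ ⟨n + 2, by omega⟩ where
  injective := Fin.castLE_injective (by omega)
  ne := by simp
  left_notMem := by
    rintro ⟨x, hx⟩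
    exact x.2.ne (congrArg Fin.val hx)
  right_notMem := by
    rintro ⟨x, hx⟩
    exact (x.2.trans (Nat.lt_succ_self _)).ne (congrArg Fin.val hx)
  left_adj := (parentGraph_adj_iff hq).2 (Or.inr ⟨Nat.succ_ne_zero _, hn⟩)
  right_adj := (parentGraph_adj_iff hq).2 (Or.inr ⟨Nat.succ_ne_zero _, hn'⟩)
  edge_cases := by
    simp only [edgeSet_parentGraph hq, Set.forall_mem_range, Set.exists_range_iff, map_parentEdge,
      parentEdge_eq_mk_iff]
    intro e
    obtain he | he | he : e.val < n ∨ e.val = n ∨ e.val = n + 1 := by omega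
    · exact Or.inl ⟨⟨e, he⟩, rfl⟩
    · exact Or.inr (Or.inl (Or.inl ⟨by rw [he], by rw [he, hn]; rfl⟩))
    · exact Or.inr (Or.inr (Or.inl ⟨by rw [he], by rw [he, hn']; rfl⟩))

end ParentGraph

section ForkedPath

variable {m i : ℕ}

/-- The parents of the vertices `1, 2, …` of a forked path: the spine consists of `0, …, m`, and
the pairs `m + 1, m + 2` and `m + 3, m + 4` and so on are attached to `0, m, m + 1, m + 2, …`. -/
def forkParent (m e : ℕ) : ℕ :=
  if e < m then e else if e < m + 2 then 0 else m + (e - m - 2) / 2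

/-- The path `0, …, m` with `i` forks attached one after another: the first one at `0`, the others
at the successive leaves of a binary tree that grows from `m`. -/
abbrev forkedPath (m i : ℕ) : SimpleGraph (Fin (m + 2 * i + 1)) :=
  parentGraph (forkParent m) (m + 2 * i)

theorem forkParent_le (m e : ℕ) : forkParent m e ≤ e := by
  unfold forkParent
  split_ifs <;> omega

theorem degree_forkedPath (hm : 0 < m) (v : Fin (m + 2 * i + 1)) :
    (forkedPath m i).degree v = if v.val = 0 then if i = 0 then 1 else 3 else if v.val < m then 2
      else if v + 2 ≤ m + i then 3 else 1 := by
  rw [degree_parentGraph (forkParent_le m)]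
  have hv := v.2
  split_ifs with hroot hi hspine hinner
  · rw [Finset.card_eq_one]
    refine ⟨0, ?_⟩
    ext e
    rw [Finset.mem_filter]
    simp only [Finset.mem_range, forkParent, Finset.mem_singleton]
    split_ifs <;> omega
  · rw [Finset.card_eq_three]
    refine ⟨0, m, m + 1, by omega, by omega, by omega, ?_⟩
    ext e
    rw [Finset.mem_filter]
    simp only [Finset.mem_range, forkParent, Finset.mem_insert, Finset.mem_singleton]
    split_ifs <;> omega
  · rw [Finset.card_eq_two]
    refine ⟨v - 1, v, by omega, ?_⟩
    ext e
    rw [Finset.mem_filter]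
    simp only [Finset.mem_range, forkParent, Finset.mem_insert, Finset.mem_singleton]
    split_ifs <;> omega
  · rw [Finset.card_eq_three]
    refine ⟨v - 1, m + 2 + 2 * (v - m), m + 3 + 2 * (v - m), by omega, by omega, by omega, ?_⟩
    ext e
    rw [Finset.mem_filter]
    simp only [Finset.mem_range, forkParent, Finset.mem_insert, Finset.mem_singleton]
    split_ifs <;> omega
  · rw [Finset.card_eq_one]
    refine ⟨v - 1, ?_⟩
    ext e
    rw [Finset.mem_filter]
    simp only [Finset.mem_range, forkParent, Finset.mem_singleton]
    split_ifs <;> omega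

theorem card_lowDegree_forkedPath (hm : 0 < m) (hi : 0 < i) :
    (lowDegree (forkedPath m i)).card = m + i + 1 := by
  have hlow : lowDegree (forkedPath m i) =
      ({v | v.val ∈ Finset.Ico 1 m ∪ Finset.Ico (m + i - 1) (m + 2 * i + 1)} : Finset _) := by
    ext v
    rw [mem_lowDegree, degree_forkedPath hm]
    simp only [Finset.mem_filter_univ, Finset.mem_union, Finset.mem_Ico]
    split_ifs <;> omega
  have hdisj : Disjoint (Finset.Ico 1 m) (Finset.Ico (m + i - 1) (m + 2 * i + 1)) :=
    Finset.disjoint_left.2 fun v => by simp only [Finset.mem_Ico]; omega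
  rw [hlow, Finset.card_filter, Fin.sum_univ_eq_sum_range (fun v => if v ∈ _ then 1 else 0),
    ← Finset.card_filter, Finset.filter_mem_eq_inter, Finset.inter_eq_right.2,
    Finset.card_union_of_disjoint hdisj, Nat.card_Ico, Nat.card_Ico]
  · omega
  · intro v
    simp only [Finset.mem_union, Finset.mem_Ico, Finset.mem_range]
    omega

theorem isLeafCubic_forkedPath (hm : 2 ≤ m) (hi : 2 ≤ i) : IsLeafCubic (forkedPath m i) where
  degree_pos v := by
    rw [degree_forkedPath (by omega)]
    split_ifs <;> omega
  degree_eq_three {v w} hv hvw := by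
    rw [parentGraph_adj_iff (forkParent_le m)] at hvw
    rw [degree_forkedPath (by omega)] at hv ⊢
    unfold forkParent at hvw
    split_ifs at * <;> omega
  exists_nonleaf {w} hw := by
    rw [degree_forkedPath (by omega)] at hw
    by_cases hroot : w.val = 0
    · refine ⟨⟨1, by omega⟩, (parentGraph_adj_iff (forkParent_le m)).2 (Or.inl ?_), ?_⟩
      · simp [forkParent, hroot, show 0 < m by omega]
      · rw [degree_forkedPath (by omega)]
        dsimp only
        split_ifs <;> omega
    · have hle := forkParent_le m (w - 1)
      refine ⟨⟨forkParent m (w - 1), by omega⟩,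
        (parentGraph_adj_iff (forkParent_le m)).2 (Or.inr ⟨hroot, rfl⟩), ?_⟩
      rw [degree_forkedPath (by omega)]
      dsimp only
      unfold forkParent at *
      split_ifs at * <;> omega

/-- The inclusion of a forked path into the one with an additional fork. -/
abbrev forkedPathHom (m i : ℕ) : forkedPath m i →g forkedPath m (i + 1) :=
  parentGraphHom (forkParent_le m) (Nat.le_add_right (m + 2 * i) 2)

theorem exists_isFork_forkedPathHom {l : Fin (m + 2 * i + 1)}
    (hl : forkParent m (m + 2 * i) = l) : ∃ a b, IsFork (forkedPathHom m i) l a b :=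
  ⟨_, _, isFork_parentGraphHom (forkParent_le m) hl (by
    rw [← hl]
    unfold forkParent
    split_ifs <;> omega)⟩

end ForkedPath

section LowerBound

variable {m i M : ℕ} {p : ι → GraphPath (forkedPath m i)} {c : ι → C}

theorem isCubicAt_forkedPath {u v x y : Fin (m + 2 * i + 1)} (hv : m < v)
    (hx : x + m = 2 * v.val + 3) (hy : y + m = 2 * v.val + 4) (hu : forkParent m (v - 1) = u) :
    IsCubicAt (forkedPath m i) v x y u := by
  have hle := forkParent_le m (v - 1)
  refine ⟨?_, ?_, ?_, fun t => ?_⟩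
  iterate 3
    rw [ne_eq, Fin.ext_iff]
    omega
  · rw [parentGraph_adj_iff (forkParent_le m), Fin.ext_iff, Fin.ext_iff, Fin.ext_iff, ← hu]
    unfold forkParent at *
    split_ifs <;> omega

/-- The edge of a forked path that joins `e + 1` to its parent. -/
abbrev forkEdge (m i : ℕ) (e : Fin (m + 2 * i)) : Sym2 (Fin (m + 2 * i + 1)) :=
  parentEdge (forkParent_le m) e

theorem exists_isCubicAt_forkEdge (hm : 0 < m) (hi : 0 < i) {e : Fin (m + 2 * i)} (he : m ≤ e)
    (hei : e + 3 ≤ m + i) : ∃ (x y : Fin (m + 2 * i)) (v a b u : Fin (m + 2 * i + 1)),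
      (e < x ∧ x.val ≤ 2 * e + 5) ∧ (e < y ∧ y.val ≤ 2 * e + 5) ∧
      (forkedPath m i).degree v = 3 ∧ IsCubicAt (forkedPath m i) v a b u ∧
      forkEdge m i e = s(v, u) ∧ forkEdge m i x = s(v, a) ∧ forkEdge m i y = s(v, b) := by
  have hchild {d : ℕ} (hd : d + m = 2 * e + 4 ∨ d + m = 2 * e + 5) : forkParent m d = e + 1 := by
    unfold forkParent
    split_ifs <;> omega
  let x : Fin (m + 2 * i) := ⟨2 * e + 4 - m, by omega⟩
  let y : Fin (m + 2 * i) := ⟨2 * e + 5 - m, by omega⟩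
  have hx : x + m = 2 * e.val + 4 := Nat.sub_add_cancel (by omega)
  have hy : y + m = 2 * e.val + 5 := Nat.sub_add_cancel (by omega)
  refine ⟨x, y, e.succ, x.succ, y.succ, _, ⟨Fin.lt_def.2 (by omega), by omega⟩,
    ⟨Fin.lt_def.2 (by omega), by omega⟩, ?_, ?_, rfl, ?_, ?_⟩
  · rw [degree_forkedPath hm, Fin.val_succ]
    split_ifs <;> omega
  · refine isCubicAt_forkedPath ?_ ?_ ?_ rfl <;> simp only [Fin.val_succ] <;> omega
  · exact (parentEdge_eq_mk_iff _).2 (Or.inr ⟨rfl, hchild (Or.inl hx)⟩)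
  · exact (parentEdge_eq_mk_iff _).2 (Or.inr ⟨rfl, hchild (Or.inr hy)⟩)

theorem ncard_pathsThrough_forkEdge [Fintype ι] (hm : 2 ≤ m) (hi : 2 ≤ i)
    (hp : Separates (forkedPath m i) p) (hcard : Fintype.card ι = (lowDegree (forkedPath m i)).card)
    {e : Fin (m + 2 * i)} (he : m ≤ e) : (pathsThrough p (forkEdge m i e)).ncard = 2 := by
  have hG := isLeafCubic_forkedPath hm hi
  induction e using WellFoundedGT.induction with
  | _ e ih =>
    by_cases hei : e + 3 ≤ m + i
    · obtain ⟨x, y, v, a, b, u, ⟨hex, -⟩, ⟨hey, -⟩, hv, hcubic, heq, hxeq, hyeq⟩ :=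
        exists_isCubicAt_forkEdge (by omega) (by omega) he hei
      rw [heq]
      exact hcubic.ncard_pathsThrough_eq_two hp (hG.not_isEnd hp hcard hv)
        (hxeq ▸ ih x hex (he.trans hex.le)) (hyeq ▸ ih y hey (he.trans hey.le))
    · have hadj : forkEdge m i e ∈ (forkedPath m i).edgeSet := by
        rw [edgeSet_parentGraph (forkParent_le m)]
        exact ⟨e, rfl⟩
      refine hG.ncard_pathsThrough_eq_two hp hcard ?_ hadj
      rw [degree_forkedPath (by omega), Fin.val_succ]
      rw [if_neg (by omega), if_neg (by omega), if_neg (by omega)]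

theorem exists_forkEdge_mem_edges (hm : 0 < m) (hi : 0 < i) {P : GraphPath (forkedPath m i)}
    (hend : ∀ v, (forkedPath m i).degree v = 3 → ¬ P.IsEnd v) {e : Fin (m + 2 * i)} (he : m ≤ e)
    (hei : e + 3 ≤ m + i) (hmem : forkEdge m i e ∈ P.edges) :
    ∃ w, (e < w ∧ w.val ≤ 2 * e + 5) ∧ forkEdge m i w ∈ P.edges := by
  obtain ⟨x, y, v, a, b, u, hx, hy, hv, hcubic, heq, hxeq, hyeq⟩ :=
    exists_isCubicAt_forkEdge hm hi he hei
  rw [heq, hcubic.mem_edges_iff_xor (hend v hv), ← hxeq, ← hyeq] at hmem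
  obtain ⟨hmem, -⟩ | ⟨hmem, -⟩ := hmem
  exacts [⟨x, hx, hmem⟩, ⟨y, hy, hmem⟩]

theorem le_mul_two_pow_card {D : Finset ℕ} {c : ℕ}
    (hD : ∀ v ∈ D, v < M → ∃ w ∈ D, v < w ∧ w ≤ 2 * v + c) {v : ℕ} (hv : v ∈ D) :
    M ≤ (v + c) * 2 ^ {w ∈ D | v < w}.card := by
  induction h : M - v using Nat.strong_induction_on generalizing v with
  | _ d ih =>
    by_cases hvM : v < M
    · obtain ⟨w, hw, hvw, hle⟩ := hD v hv hvM
      have hlt : {u ∈ D | w < u}.card < {u ∈ D | v < u}.card := by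
        refine Finset.card_lt_card (Finset.ssubset_iff_of_subset ?_ |>.2 ⟨w, by simp [hw, hvw]⟩)
        exact Finset.monotone_filter_right D fun u _ hu => hvw.trans hu
      calc
        M ≤ (w + c) * 2 ^ {u ∈ D | w < u}.card := ih (M - w) (by omega) hw rfl
        _ ≤ ((v + c) * 2) * 2 ^ {u ∈ D | w < u}.card := Nat.mul_le_mul_right _ (by omega)
        _ = (v + c) * 2 ^ ({u ∈ D | w < u}.card + 1) := by ring
        _ ≤ (v + c) * 2 ^ {u ∈ D | v < u}.card := by gcongr; exacts [one_le_two, hlt]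
    · calc
        M ≤ v + c := by omega
        _ ≤ (v + c) * 2 ^ {u ∈ D | v < u}.card := Nat.le_mul_of_pos_right _ (by positivity)

theorem RainbowSeparates.le_of_forkedPath [Fintype ι] [Fintype C] (hm : 2 ≤ m) (hi : 2 ≤ i)
    (hp : RainbowSeparates (forkedPath m i) p c)
    (hcard : Fintype.card ι = (lowDegree (forkedPath m i)).card) :
    i ≤ (m + 5) * 2 ^ Fintype.card C + 2 := by
  classical
  have hG := isLeafCubic_forkedPath hm hi
  have htwo {e : Fin (m + 2 * i)} (he : m ≤ e) :=
    ncard_pathsThrough_forkEdge hm hi hp.separates hcard he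
  obtain ⟨t, ht⟩ : (pathsThrough p (forkEdge m i ⟨m, by omega⟩)).Nonempty :=
    Set.nonempty_of_ncard_ne_zero (by rw [htwo le_rfl]; exact two_ne_zero)
  let E : Finset (Fin (m + 2 * i)) := {e | m ≤ e ∧ forkEdge m i e ∈ (p t).edges}
  have hE (e) : e ∈ E ↔ m ≤ e ∧ forkEdge m i e ∈ (p t).edges := Finset.mem_filter_univ e
  have hcolors : E.card ≤ Fintype.card C := by
    rw [← Finset.card_image_of_injective E (parentEdge_injective (forkParent_le m))]
    refine hp.card_le_card_colors (i := t) (Finset.forall_mem_image.2 fun e he => ?_)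
    obtain ⟨hme, he⟩ := (hE e).1 he
    exact ⟨he, htwo hme⟩
  have hdescend : ∀ v ∈ E.map Fin.valEmbedding, v < m + i - 2 →
      ∃ w ∈ E.map Fin.valEmbedding, v < w ∧ w ≤ 2 * v + 5 := by
    simp only [Finset.mem_map, Fin.valEmbedding_apply, forall_exists_index, and_imp]
    rintro _ e he rfl hei
    obtain ⟨hme, he⟩ := (hE e).1 he
    obtain ⟨w, hw, hmem⟩ := exists_forkEdge_mem_edges (by omega) (by omega)
      (fun v hv => hG.not_isEnd hp.separates hcard hv t) hme (by omega) he
    exact ⟨w, ⟨w, (hE _).2 ⟨hme.trans hw.1.le, hmem⟩, rfl⟩, hw⟩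
  have hstart : m ∈ E.map Fin.valEmbedding :=
    Finset.mem_map.2 ⟨⟨m, by omega⟩, (hE _).2 ⟨le_rfl, ht⟩, rfl⟩
  have hle := le_mul_two_pow_card hdescend hstart
  have hpow : (m + 5) * 2 ^ {w ∈ E.map Fin.valEmbedding | m < w}.card ≤
      (m + 5) * 2 ^ Fintype.card C := by
    gcongr
    · exact one_le_two
    · exact (Finset.card_filter_le _ _).trans ((Finset.card_map _).le.trans hcolors)
  omega

end LowerBound

section ForkStep

theorem HasRainbowFamily.of_isFork [Fintype V] [DecidableRel G.Adj] {f : G →g G'} {l : V}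
    {a b : V'} {k : ℕ} (hG : IsLeafCubic G) (hf : IsFork f l a b) (hl : G.degree l = 1)
    (h : HasRainbowFamily G (lowDegree G).card k) :
    HasRainbowFamily G' ((lowDegree G).card + 1) (k + 1) := by
  obtain ⟨p, c, hp⟩ := h
  have hcard := Fintype.card_fin (lowDegree G).card
  obtain ⟨w, hlw⟩ := (G.degree_pos_iff_exists_adj l).1 (hG.degree_pos l)
  obtain ⟨i, j, -, hij⟩ := Set.ncard_eq_two.1
    (hG.ncard_pathsThrough_eq_two hp.separates hcard hl hlw)
  obtain ⟨x, y, hw⟩ := hG.exists_isCubicAt hl hlw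
  have hc : c i ≠ c j := hw.color_ne hp
    (hG.not_isEnd hp.separates hcard (hG.degree_eq_three hl hlw)) (Sym2.eq_swap ▸ hij)
  have hend : ∀ t ∈ pathsThrough p s(l, w), (p t).IsEnd l := fun _ =>
    GraphPath.isEnd_of_degree_eq_one hl
  rw [hij] at hend
  simpa using hf.hasRainbowFamily hp hlw hij hc (hend i (Or.inl rfl)) (hend j (Or.inr rfl))

theorem hasRainbowFamily_forkedPath_succ {m i k : ℕ} (hm : 2 ≤ m) (hi : 2 ≤ i)
    (h : HasRainbowFamily (forkedPath m i) (m + i + 1) k) :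
    HasRainbowFamily (forkedPath m (i + 1)) (m + (i + 1) + 1) (k + 1) := by
  have hleaf : forkParent m (m + 2 * i) = m + i - 1 := by
    unfold forkParent
    split_ifs <;> omega
  obtain ⟨a, b, hf⟩ := exists_isFork_forkedPathHom (l := ⟨m + i - 1, by omega⟩) hleaf
  have hcard := card_lowDegree_forkedPath (m := m) (i := i) (by omega) (by omega)
  rw [← hcard] at h
  rw [← add_assoc, ← hcard]
  refine h.of_isFork (isLeafCubic_forkedPath hm hi) hf ?_
  rw [degree_forkedPath (by omega), if_neg, if_neg, if_neg] <;> dsimp only <;> omega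

end ForkStep

section Spine

theorem exists_edges_eq_incidenceSet [Fintype V] [DecidableRel G.Adj] {v : V}
    (hpos : 0 < G.degree v) (hle : G.degree v ≤ 2) :
    ∃ P : GraphPath G, P.edges = G.incidenceSet v := by
  have hstar : G.incidenceSet v = (s(v, ·)) '' G.neighborFinset v := by
    ext e
    constructor
    · rintro ⟨he, hv⟩
      obtain ⟨x, rfl⟩ := Sym2.mem_iff_exists.1 hv
      exact ⟨x, (SimpleGraph.mem_neighborFinset ..).2 he, rfl⟩
    · rintro ⟨x, hx, rfl⟩
      exact ⟨(SimpleGraph.mem_neighborFinset ..).1 hx, Sym2.mem_mk_left v x⟩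
  have hadj {x} (hx : x ∈ G.neighborFinset v) : G.Adj v x :=
    (SimpleGraph.mem_neighborFinset ..).1 hx
  obtain hone | htwo : G.degree v = 1 ∨ G.degree v = 2 := by omega
  · obtain ⟨x, hx⟩ := Finset.card_eq_one.1 hone
    obtain ⟨P, hP⟩ := GraphPath.exists_edges_eq_singleton (hadj (x := x) (by simp [hx]))
    exact ⟨P, by simp [hP, hstar, hx]⟩
  · classical
    obtain ⟨x, y, hxy, hx⟩ := Finset.card_eq_two.1 htwo
    obtain ⟨P, hP⟩ := GraphPath.exists_edges_eq_pair (hadj (x := x) (by simp [hx])).symm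
      (hadj (x := y) (by simp [hx])) hxy
    exact ⟨P, by simp [hP, hstar, hx, Set.image_pair, Sym2.eq_swap (a := x)]⟩

variable {m s t : ℕ} {p : Fin (m + 1) → GraphPath (forkedPath m 0)}

/-- The member `s` of the family consists of the edges at the vertex `s`. -/
def IsStarFamily (p : V → GraphPath G) : Prop :=
  ∀ s, (p s).edges = G.incidenceSet s

/-- The colours of the stars of the spine: they run through `0, 1, 2` cyclically, except that the
colour is repeated after the second and before the last but one vertex. -/
def spineColor (m s : ℕ) : Fin 3 :=
  Fin.ofNat 3 (if s < 2 then s else if s + 1 < m then s + 2 else s + 1)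

theorem spineColor_ne_spineColor_add_two (hm : 6 ≤ m) (hdvd : 3 ∣ m) (hs : s + 2 ≤ m) :
    spineColor m s ≠ spineColor m (s + 2) := by
  simp only [spineColor, Fin.ofNat, ne_eq, Fin.mk.injEq]
  split_ifs <;> omega

theorem exists_spineColor_ne_spineColor (hm : 6 ≤ m) (hdvd : 3 ∣ m) (hst : s + 1 < t)
    (ht : t < m) : ∃ x y, (x = s ∨ x = s + 1) ∧ (y = t ∨ y = t + 1) ∧
      spineColor m x ≠ spineColor m y := by
  by_contra! h
  have h₁ := h s t (Or.inl rfl) (Or.inl rfl)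
  have h₂ := h s (t + 1) (Or.inl rfl) (Or.inr rfl)
  have h₃ := h (s + 1) t (Or.inr rfl) (Or.inl rfl)
  simp only [spineColor, Fin.ofNat, Fin.mk.injEq] at h₁ h₂ h₃
  split_ifs at h₁ h₂ h₃ <;> omega

theorem spineColor_ne_two (hdvd : 3 ∣ m) (hs : s < 2 ∨ s + 1 = m ∨ s = m) :
    spineColor m s ≠ 2 := by
  rw [spineColor, ne_eq, Fin.ext_iff, Fin.val_ofNat, Fin.val_two]
  split_ifs <;> omega

theorem exists_spineColor_ne_two (hm : 6 ≤ m) (hdvd : 3 ∣ m) (hs : s = 0 ∨ s + 1 = m) (ht : t < m)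
    (hts : t ≠ s) : ∃ x, (x = t ∨ x = t + 1) ∧ x ≠ s ∧ x ≠ s + 1 ∧ spineColor m x ≠ 2 := by
  by_contra! h
  have h₁ := h t (Or.inl rfl)
  have h₂ := h (t + 1) (Or.inr rfl)
  rw [spineColor, Fin.ext_iff, Fin.val_ofNat, Fin.val_two] at h₁ h₂
  split_ifs at h₁ h₂ <;> omega

theorem exists_isStarFamily (hm : 0 < m) :
    ∃ p : Fin (m + 1) → GraphPath (forkedPath m 0), IsStarFamily p := by
  have hdegree (v : Fin (m + 1)) :
      0 < (forkedPath m 0).degree v ∧ (forkedPath m 0).degree v ≤ 2 := by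
    rw [degree_forkedPath hm]
    split_ifs <;> omega
  exact ⟨_, fun v => (exists_edges_eq_incidenceSet (hdegree v).1 (hdegree v).2).choose_spec⟩

theorem IsStarFamily.forkEdge_mem_iff (hp : IsStarFamily p) {e : Fin m} {v : Fin (m + 1)} :
    forkEdge m 0 e ∈ (p v).edges ↔ v.val = e ∨ v.val = e + 1 := by
  rw [hp]
  refine (parentEdge_mem_incidenceSet_iff (n := m + 2 * 0) (forkParent_le m)).trans ?_
  rw [forkParent, if_pos e.2]
  omega

theorem IsStarFamily.pathsThrough_forkEdge (hp : IsStarFamily p) (e : Fin m) :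
    pathsThrough p (forkEdge m 0 e) = {e.castSucc, e.succ} := by
  ext v
  simp [mem_pathsThrough, hp.forkEdge_mem_iff, Fin.ext_iff]

theorem IsStarFamily.rainbowSeparates (hp : IsStarFamily p) (hm : 6 ≤ m) (hdvd : 3 ∣ m) :
    RainbowSeparates (forkedPath m 0) p fun v => spineColor m v := by
  have hlt {e g : Fin m} (h : e < g) : IsRainbowSeparated p (fun v => spineColor m v)
      (forkEdge m 0 e) (forkEdge m 0 g) := by
    have hg := g.2
    simp only [IsRainbowSeparated, hp.forkEdge_mem_iff]
    obtain hnext | hfar : g.val = e + 1 ∨ e + 1 < g.val := by omega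
    · refine ⟨⟨e, by omega⟩, ⟨e + 2, by omega⟩,
        spineColor_ne_spineColor_add_two (s := e) hm hdvd (by omega), ?_⟩
      dsimp only
      omega
    · obtain ⟨x, y, hx, hy, hne⟩ := exists_spineColor_ne_spineColor hm hdvd hfar hg
      refine ⟨⟨x, by omega⟩, ⟨y, by omega⟩, hne, ?_⟩
      dsimp only
      omega
  rw [RainbowSeparates, edgeSet_parentGraph (forkParent_le m)]
  rintro _ ⟨e, rfl⟩ _ ⟨g, rfl⟩ hne
  obtain h | h := lt_or_gt_of_ne (ne_of_apply_ne _ hne)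
  exacts [hlt h, (hlt h).symm]

theorem IsStarFamily.isForkable (hp : IsStarFamily p) (hm : 6 ≤ m) (hdvd : 3 ∣ m) {e : Fin m}
    (he : e.val = 0 ∨ e + 1 = m) :
    IsForkable p (fun v => spineColor m v) 2 (forkEdge m 0 e) e.castSucc e.succ := by
  refine ⟨hp.pathsThrough_forkEdge e, ?_, ?_, ?_, ?_⟩
  · simp only [spineColor, Fin.ofNat, ne_eq, Fin.mk.injEq, Fin.val_castSucc, Fin.val_succ]
    split_ifs <;> omega
  · exact spineColor_ne_two hdvd (by rw [Fin.val_castSucc]; omega)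
  · exact spineColor_ne_two hdvd (by rw [Fin.val_succ]; omega)
  · rw [edgeSet_parentGraph (forkParent_le m)]
    rintro _ ⟨g, rfl⟩ hne
    obtain ⟨x, hx, hxe, hxe', hx2⟩ := exists_spineColor_ne_two hm hdvd he g.2
      (fun h => hne (congrArg _ (Fin.ext h)))
    have hg := g.2
    refine ⟨⟨x, by omega⟩, hp.forkEdge_mem_iff.2 hx, ?_, hx2⟩
    rw [hp.forkEdge_mem_iff]
    exact not_or.2 ⟨hxe, hxe'⟩

theorem isEnd_of_forkEdge_mem {i : ℕ} {P : GraphPath (forkedPath m i)} {v : Fin (m + 2 * i + 1)}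
    {e : Fin (m + 2 * i)} (hm : 0 < m) (hv : v.val = 0 ∧ i = 0 ∨ v.val = m ∧ i < 2)
    (he : e + 1 = v.val ∨ forkParent m e = v) (hmem : forkEdge m i e ∈ P.edges) : P.IsEnd v := by
  refine GraphPath.isEnd_of_existsUnique_adj (SimpleGraph.degree_eq_one_iff_existsUnique_adj.1 ?_)
    ((mem_parentEdge_iff _).2 he) hmem
  rw [degree_forkedPath hm]
  split_ifs <;> omega

theorem exists_isForkable_forkedPath_one (hm : 6 ≤ m) (hdvd : 3 ∣ m) :
    ∃ (p : Option (Fin (m + 1)) → GraphPath (forkedPath m 1)) (c : Option (Fin (m + 1)) → Fin 3)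
      (e : Fin (m + 2)) (i j : Option (Fin (m + 1))), e + 1 = m ∧
      RainbowSeparates (forkedPath m 1) p c ∧ IsForkable p c 2 (forkEdge m 1 e) i j := by
  have hm₀ : 0 < m := by omega
  obtain ⟨p, hp⟩ := exists_isStarFamily hm₀
  let left : Fin m := ⟨0, hm₀⟩
  let right : Fin m := ⟨m - 1, by omega⟩
  have hright_val : right + 1 = m := Nat.sub_add_cancel hm₀
  have hleft := hp.isForkable hm hdvd (e := left) (Or.inl rfl)
  have hright := hp.isForkable hm hdvd (e := right) (Or.inr hright_val)
  have hend : ∀ t ∈ pathsThrough p (forkEdge m 0 left), (p t).IsEnd 0 := fun t =>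
    isEnd_of_forkEdge_mem hm₀ (Or.inl ⟨rfl, rfl⟩) (Or.inr (if_pos hm₀))
  have hnotMem : ∀ t ∈ pathsThrough p (forkEdge m 0 left), forkEdge m 0 right ∉ (p t).edges := by
    intro t
    rw [mem_pathsThrough, hp.forkEdge_mem_iff, hp.forkEdge_mem_iff]
    dsimp only [left]
    omega
  rw [hp.pathsThrough_forkEdge] at hend hnotMem
  obtain ⟨a, b, hf⟩ := exists_isFork_forkedPathHom (m := m) (i := 0) (l := 0) (by simp [forkParent])
  obtain ⟨p', hp'⟩ := hf.exists_isForkFamily hleft.ne (hend _ (Or.inl rfl)) (hend _ (Or.inr rfl))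
  exact ⟨p', _, right.castLE (by omega), _, _, hright_val,
    hp'.rainbowSeparates hf (hp.rainbowSeparates hm hdvd) hleft,
    hp'.isForkable_map hf hleft.left_ne hleft.right_ne hright (hnotMem _ (Or.inl rfl))
      (hnotMem _ (Or.inr rfl))⟩

theorem hasRainbowFamily_forkedPath_two (hm : 6 ≤ m) (hdvd : 3 ∣ m) :
    HasRainbowFamily (forkedPath m 2) (m + 3) 3 := by
  obtain ⟨p, c, e, i, j, he, hp, hc⟩ := exists_isForkable_forkedPath_one hm hdvd
  have hend : ∀ t ∈ pathsThrough p (forkEdge m 1 e), (p t).IsEnd ⟨m, by omega⟩ := fun t =>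
    isEnd_of_forkEdge_mem (by omega) (Or.inr ⟨rfl, one_lt_two⟩) (Or.inl he)
  rw [hc.pathsThrough_eq] at hend
  obtain ⟨a, b, hf⟩ := exists_isFork_forkedPathHom (m := m) (i := 1) (l := ⟨m, by omega⟩)
    (by simp [forkParent])
  obtain ⟨p', hp'⟩ := hf.exists_isForkFamily hc.ne (hend _ (Or.inl rfl)) (hend _ (Or.inr rfl))
  simpa using (hp'.rainbowSeparates hf hp hc).hasRainbowFamily

end Spine

theorem exists_isLeast_setOf {P : ℕ → ℕ → Prop} {a k : ℕ} (hzero : P 0 a)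
    (hsucc : ∀ i j, P i j → P (i + 1) (j + 1)) (hunbounded : ∀ k, ∃ i, ∀ j, P i j → k ≤ j)
    (hk : a ≤ k) : ∃ i, IsLeast {j | P i j} k := by
  classical
  have hex := hunbounded k
  obtain hfind | ⟨i, hi⟩ : Nat.find hex = 0 ∨ ∃ i, Nat.find hex = i + 1 :=
    (Nat.eq_zero_or_eq_succ_pred _).imp_right fun h => ⟨_, h⟩
  · have hlower := Nat.find_spec hex
    rw [hfind] at hlower
    exact ⟨0, hk.antisymm (hlower a hzero) ▸ hzero, fun j hj => hlower j hj⟩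
  · have hlower := Nat.find_spec hex
    have hsmall := Nat.find_min hex (m := i) (by omega)
    rw [hi] at hlower
    push Not at hsmall
    obtain ⟨j, hj, hjk⟩ := hsmall
    have hnext := hsucc i j hj
    exact ⟨i + 1, le_antisymm hjk (hlower _ hnext) ▸ hnext, fun j hj => hlower j hj⟩

theorem chromaticSepNumber_forkedPath {m i k : ℕ} (hm : 2 ≤ m) (hi : 2 ≤ i) (hk : 2 ≤ k)
    (h : IsLeast {j | HasRainbowFamily (forkedPath m i) (m + i + 1) j} k) :
    chromaticSepNumber (forkedPath m i) = k := by
  refine chromaticSepNumber_eq_of_isLeast (fun n p hp => ?_) hk h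
  have hle := (isLeafCubic_forkedPath hm hi).card_lowDegree_le hp
  rwa [card_lowDegree_forkedPath (by omega) (by omega), Fintype.card_fin] at hle

theorem exists_chromaticSepNumber_forkedPath {m k : ℕ} (hm : 6 ≤ m) (hdvd : 3 ∣ m) (hk : 3 ≤ k) :
    ∃ i, chromaticSepNumber (forkedPath m i) = k := by
  have hunbounded (k : ℕ) : ∃ i, ∀ j,
      HasRainbowFamily (forkedPath m (i + 2)) (m + (i + 2) + 1) j → k ≤ j := by
    refine ⟨(m + 5) * 2 ^ k + 1, fun j ⟨p, c, hp⟩ => ?_⟩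
    have hle := hp.le_of_forkedPath (by omega) (by omega)
      (by rw [card_lowDegree_forkedPath (by omega) (by omega), Fintype.card_fin])
    rw [Fintype.card_fin] at hle
    have hlt : (m + 5) * 2 ^ k < (m + 5) * 2 ^ j := by omega
    exact ((Nat.pow_lt_pow_iff_right one_lt_two).1 (Nat.lt_of_mul_lt_mul_left hlt)).le
  obtain ⟨i, hi⟩ := exists_isLeast_setOf
    (P := fun i j => HasRainbowFamily (forkedPath m (i + 2)) (m + (i + 2) + 1) j)
    (hasRainbowFamily_forkedPath_two hm hdvd)
    (fun _ _ => hasRainbowFamily_forkedPath_succ (by omega) (Nat.le_add_left 2 _)) hunbounded hk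
  exact ⟨i + 2, chromaticSepNumber_forkedPath (by omega) (Nat.le_add_left 2 i) (by omega) hi⟩

theorem exists_isTree_chromaticSepNumber_eq {k : ℕ} (hk : 3 ≤ k) (N : ℕ) :
    ∃ n > N, ∃ T : SimpleGraph (Fin n), T.IsTree ∧ chromaticSepNumber T = k := by
  obtain ⟨i, hi⟩ := exists_chromaticSepNumber_forkedPath (m := 3 * N + 6) (by omega) (by omega) hk
  exact ⟨_, by omega, _, isTree_parentGraph (forkParent_le _), hi⟩

end RainbowSep

/-- For every `k ≥ 3` there is an infinite sequence of pairwise non-isomorphic finite trees with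
chromatic separation number `k`. -/
theorem mainTheorem12 (k : ℕ) (hk : 3 ≤ k) :
    ∃ (n : ℕ → ℕ) (T : ∀ i : ℕ, SimpleGraph (Fin (n i))),
      (∀ i, (T i).IsTree ∧ RainbowSep.chromaticSepNumber (T i) = (k : ℕ∞)) ∧
      ∀ i j, i ≠ j → IsEmpty (T i ≃g T j) := by
  obtain ⟨n, hn, hT⟩ :=
    Nat.exists_strictMono_subsequence (RainbowSep.exists_isTree_chromaticSepNumber_eq hk)
  choose T hT using hT
  refine ⟨n, T, hT, fun i j hij => ⟨fun e => hij (hn.injective ?_)⟩⟩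
  simpa using Fintype.card_congr e.toEquiv
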